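/- Let $d\ge 1$, let $\beta,L,c_0,r_0,t_0>0$ and $0<\mu_{\min}<\mu_{\max}<\infty$, and let $\lfloor\beta\rfloor$ denote the maximal integer strictly less than $\beta$. Let $K:\mathbb R^d\to[0,\infty)$ be a measurable kernel such that $K(u)\ge c\,\mathbf 1\{\|u\|\le c\}$ for all $u$ with some $c>0$, $\int K(u)\,du=1$, $\int(1+\|u\|^{4\beta})K^2(u)\,du<\infty$ and $\sup_u(1+\|u\|^{2\beta})K(u)<\infty$, where $\|\cdot\|$ is the Euclidean norm. **The class of distributions.** For a compact set $\mathcal C\subset\mathbb R^d$ let $\mathcal P_{\Sigma,\infty}(\mathcal C)$ be the class of all probability distributions $P$ of $(X,Y)$ on $\mathbb R^d\times\{0,1\}$, with marginal $P_X$ and (a version of the) regression function $\eta(X)=P(Y=1\mid X)$, such that: 1. $P_X(0<|\eta(X)-1/2|\le t_0)=0$ (margin condition with "$\alpha=\infty$"); 2. $\eta$ belongs to the Hölder class $\Sigma(\beta,L,\mathbb R^d)$: $\eta:\mathbb R^d\to\mathbb R$ is $\lfloor\beta\rfloor$ times continuously differentiable and $|\eta(x')-\eta_x(x')|\le L\|x-x'\|^\beta$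 for all $x,x'\in\mathbb R^d$, where $\eta_x(x')=\sum_{|s|\le\lfloor\beta\rfloor}\frac{(x'-x)^s}{s!}D^s\eta(x)$ is the Taylor polynomial of $\eta$ at $x$; 3. (strong density assumption) there is a compact set $A\subseteq\mathcal C$ with $\lambda[A\cap B(x,r)]\ge c_0\lambda[B(x,r)]$ for all $0<r\le r_0$ and $x\in A$ (where $\lambda$ is Lebesgue measure and $B(x,r)$ is the closed ball), and $P_X$ has a density $\mu$ with respect to $\lambda$ with $\mu_{\min}\le\mu\le\mu_{\max}$ on $A$ and $\mu=0$ outside $A$. **The classifier.** Let $(X_1,Y_1),\dots,(X_n,Y_n)$ be i.i.d. with law $P$, and let $h>0$. For $x\in\mathbb R^d$ let $\hat\eta^{LP}(x)=\hat\theta_x(0)$ if the criterion $\sum_{i=1}^n[Y_i-\theta(X_i-x)]^2K\big(\frac{X_i-x}{h}\big)$ has a unique minimizer $\hat\theta_x$ among the polynomials $\theta$ on $\mathbb R^d$ of degree at most $\lfloor\beta\rfloor$, and $\hat\eta^{LP}(x)=0$ otherwise. Let $\bar\Omega=(\bar\Omega_{s_1,s_2})_{|s_1|,|s_2|\le\lfloor\beta\rfloor}$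 be the matrix indexed by multi-indices with $\bar\Omega_{s_1,s_2}=\frac1{nh^d}\sum_{i=1}^n\big(\frac{X_i-x}{h}\big)^{s_1+s_2}K\big(\frac{X_i-x}{h}\big)$. Let $\hat\eta^*(x)$ be the projection of $\hat\eta^{LP}(x)$ on $[0,1]$ if the smallest eigenvalue of $\bar\Omega$ is greater than $(\log n)^{-1}$ (with $(\log 1)^{-1}=+\infty$), and $\hat\eta^*(x)=0$ otherwise. The plug-in classifier with bandwidth $h$ is $\hat f_n^*=\mathbf 1\{\hat\eta^*\ge 1/2\}$. **Claim.** There exist $h>0$ (independent of $n$) and constants $C_4,C_5>0$, depending only on $t_0,\beta,d,L,c_0,r_0,\mu_{\min},\mu_{\max}$ and $K$, such that for every $n\ge1$ the map $\hat f_n^*$ with bandwidth $h$ is jointly measurable in the sample and the point $x$, and for every compact $\mathcal C\subset\mathbb R^d$ $$\sup_{P\in\mathcal P_{\Sigma,\infty}(\mathcal C)}\big\{\mathbb E R(\hat f_n^*)-R(f^*)\big\}\le C_4\exp(-C_5n),$$ where $R(f)=P(Y\ne f(X))$, $f^*=\mathbf 1\{\eta\ge1/2\}$ is the Bayes rule,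 and $\mathbb E$ is the expectation over the sample. (If the class is empty the bound is vacuous.) -/

import Mathlib

open MeasureTheory ProbabilityTheory

noncomputable section

namespace PlugIn

/-- The feature space `ℝ^d` with its Euclidean norm. -/
abbrev Feature (d : ℕ) : Type := EuclideanSpace ℝ (Fin d)

/-- The observation space `ℝ^d × {0, 1}`, carrying pairs `(x, y)`. -/
abbrev Obs (d : ℕ) : Type := Feature d × Fin 2

/-! ### Classification -/

/-- Misclassification risk `R(f) = P(Y ≠ f(X))` of a decision rule `f`. -/
def risk {d : ℕ} (P : Measure (Obs d)) (f : Feature d → Fin 2) : ℝ :=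
  P.real {z | z.2 ≠ f z.1}

/-- The plug-in rule `1{g ≥ 1/2}`; for `g` the regression function this is the Bayes rule. -/
def plugInRule {d : ℕ} (g : Feature d → ℝ) (x : Feature d) : Fin 2 :=
  open Classical in if 1 / 2 ≤ g x then 1 else 0

/-- `η` is (a version of) the regression function `η(X) = P(Y = 1 | X)`. -/
def IsRegressionFunction {d : ℕ} (P : Measure (Obs d)) (η : Feature d → ℝ) : Prop :=
  Measurable η ∧
    P⟦{z : Obs d | z.2 = 1}|MeasurableSpace.comap Prod.fst inferInstance⟧
      =ᵐ[P] fun z => η z.1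

/-- Excess risk `E R(f̂) - R(f*)` of a classifier based on an i.i.d. sample of size `n` from `P`,
where `η` is the regression function of `P` and `f* = 1{η ≥ 1/2}`. -/
def excessRisk {d n : ℕ} (P : Measure (Obs d)) (η : Feature d → ℝ)
    (f : (Fin n → Obs d) → Feature d → Fin 2) : ℝ :=
  (∫ D, risk P (f D) ∂(Measure.pi fun _ : Fin n => P)) - risk P (plugInRule η)

/-! ### Hölder classes and the strong density assumption -/

/-- The maximal integer strictly less than `β` (for `β > 0`). -/
def lfloor (β : ℝ) : ℕ := ⌈β⌉₊ - 1

/-- The Taylor polynomial of `g` of degree `l` at `x`, evaluated at `x'`. The term of order `k` is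
`(1/k!) D^k g(x)[x'-x, …, x'-x] = ∑_{|s| = k} (x'-x)^s D^s g(x) / s!`. -/
def taylorAt {d : ℕ} (l : ℕ) (g : Feature d → ℝ) (x x' : Feature d) : ℝ :=
  ∑ k ∈ Finset.range (l + 1),
    ((k.factorial : ℝ)⁻¹) * iteratedFDeriv ℝ k g x (fun _ => x' - x)

/-- The Hölder class `Σ(β, L, ℝ^d)`. -/
def HolderClass {d : ℕ} (β L : ℝ) (g : Feature d → ℝ) : Prop :=
  ContDiff ℝ (lfloor β) g ∧
    ∀ x x' : Feature d, |g x' - taylorAt (lfloor β) g x x'| ≤ L * ‖x - x'‖ ^ β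

/-- `(c₀, r₀)`-regular sets. -/
def IsRegularSet {d : ℕ} (c₀ r₀ : ℝ) (A : Set (Feature d)) : Prop :=
  NullMeasurableSet A ∧
    ∀ r : ℝ, 0 < r → r ≤ r₀ → ∀ x ∈ A,
      ENNReal.ofReal c₀ * volume (Metric.closedBall x r) ≤ volume (A ∩ Metric.closedBall x r)

/-- The strong density assumption for a law `Q` on `ℝ^d`: it has a density which lies in
`[μmin, μmax]` on a compact `(c₀, r₀)`-regular set `A ⊆ C` and vanishes off `A`. -/
def StrongDensity {d : ℕ} (c₀ r₀ μmin μmax : ℝ) (C : Set (Feature d))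
    (Q : Measure (Feature d)) : Prop :=
  ∃ (A : Set (Feature d)) (μ : Feature d → ℝ),
    IsCompact A ∧ A ⊆ C ∧ IsRegularSet c₀ r₀ A ∧ Measurable μ ∧
    (∀ x ∈ A, μmin ≤ μ x ∧ μ x ≤ μmax) ∧ (∀ x, x ∉ A → μ x = 0) ∧
    Q = volume.withDensity (fun x => ENNReal.ofReal (μ x))

/-- `P` is a probability distribution on `ℝ^d × {0, 1}` with regression function `η`, satisfying
the margin condition with `α = ∞` at level `t₀`, Hölder smoothness of `η`, and the strong density
assumption on the marginal law of `X`. -/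
structure InClass {d : ℕ} (β L c₀ r₀ μmin μmax t₀ : ℝ) (C : Set (Feature d))
    (P : Measure (Obs d)) (η : Feature d → ℝ) : Prop where
  isProb : IsProbabilityMeasure P
  regression : IsRegressionFunction P η
  margin : P.fst {x | 0 < |η x - 1 / 2| ∧ |η x - 1 / 2| ≤ t₀} = 0
  holder : HolderClass β L η
  density : StrongDensity c₀ r₀ μmin μmax C P.fst

/-! ### Locally polynomial estimators -/

/-- The conditions on the kernel `K : ℝ^d → [0, ∞)`. -/
structure IsAdmissibleKernel {d : ℕ} (β : ℝ) (K : Feature d → ℝ) : Prop where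
  measurable : Measurable K
  nonneg : ∀ u, 0 ≤ K u
  lower : ∃ c : ℝ, 0 < c ∧ ∀ u, ‖u‖ ≤ c → c ≤ K u
  integral_eq_one : Integrable K ∧ ∫ u, K u = 1
  moment : Integrable fun u => (1 + ‖u‖ ^ (4 * β)) * K u ^ 2
  bounded : BddAbove (Set.range fun u => (1 + ‖u‖ ^ (2 * β)) * K u)

/-- The weighted least squares criterion `∑ᵢ (Yᵢ - θ(Xᵢ - x))² K((Xᵢ - x)/h)`. -/
def lpCriterion {d n : ℕ} (K : Feature d → ℝ) (h : ℝ) (D : Fin n → Obs d) (x : Feature d)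
    (θ : MvPolynomial (Fin d) ℝ) : ℝ :=
  ∑ i, ((((D i).2 : ℕ) : ℝ) - MvPolynomial.eval (fun j => ((D i).1 - x) j) θ) ^ 2 *
    K (h⁻¹ • ((D i).1 - x))

/-- `θ` minimizes the criterion among the polynomials of degree at most `l`. -/
def IsLPMinimizer {d n : ℕ} (l : ℕ) (K : Feature d → ℝ) (h : ℝ) (D : Fin n → Obs d)
    (x : Feature d) (θ : MvPolynomial (Fin d) ℝ) : Prop :=
  θ.totalDegree ≤ l ∧
    ∀ θ' : MvPolynomial (Fin d) ℝ, θ'.totalDegree ≤ l →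
      lpCriterion K h D x θ ≤ lpCriterion K h D x θ'

/-- The `LP(l)` estimator at `x`: the value at `0` of the minimizer if it is unique, else `0`. -/
def lpEstimator {d n : ℕ} (l : ℕ) (K : Feature d → ℝ) (h : ℝ) (D : Fin n → Obs d)
    (x : Feature d) : ℝ :=
  open Classical in
  if H : ∃! θ : MvPolynomial (Fin d) ℝ, IsLPMinimizer l K h D x θ then
    MvPolynomial.eval (fun _ => 0) H.choose
  else 0

/-- Multi-indices `s ∈ ℕ^d` with `|s| ≤ l` (each coordinate is then at most `l`). -/
abbrev MultiIndex (d l : ℕ) : Type := {s : Fin d → Fin (l + 1) // ∑ j, (s j : ℕ) ≤ l}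

/-- The matrix with entries `(n h^d)⁻¹ ∑ᵢ ((Xᵢ-x)/h)^(s₁+s₂) K((Xᵢ-x)/h)`, `|s₁|, |s₂| ≤ l`. -/
def designMatrix {d n : ℕ} (l : ℕ) (K : Feature d → ℝ) (h : ℝ) (D : Fin n → Obs d)
    (x : Feature d) : Matrix (MultiIndex d l) (MultiIndex d l) ℝ :=
  fun s₁ s₂ => ((n : ℝ) * h ^ d)⁻¹ *
    ∑ i, (∏ j, ((h⁻¹ • ((D i).1 - x)) j) ^ ((s₁.1 j : ℕ) + (s₂.1 j : ℕ))) *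
      K (h⁻¹ • ((D i).1 - x))

/-- The smallest eigenvalue of a real symmetric matrix (the least element of its real spectrum). -/
def minEigenvalue {ι : Type} [Fintype ι] [DecidableEq ι] (M : Matrix ι ι ℝ) : ℝ :=
  sInf (spectrum ℝ M)

/-- The regression estimator `η̂*`: the projection on `[0, 1]` of the `LP(l)` estimator, `l` the
maximal integer strictly less than `β`, when the smallest eigenvalue of the design matrix exceeds
`(log n)⁻¹`, and `0` otherwise. The comparison is multiplied out, so that for `n = 1`, where
`(log n)⁻¹ = +∞`, the estimator is `0`. -/
def etaStar {d n : ℕ} (β : ℝ) (K : Feature d → ℝ) (h : ℝ) (D : Fin n → Obs d)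
    (x : Feature d) : ℝ :=
  open Classical in
  if 1 < minEigenvalue (designMatrix (lfloor β) K h D x) * Real.log n then
    max 0 (min 1 (lpEstimator (lfloor β) K h D x))
  else 0

/-- The plug-in classifier `1{η̂* ≥ 1/2}` with bandwidth `h`. -/
def plugInClassifier {d n : ℕ} (β : ℝ) (K : Feature d → ℝ) (h : ℝ) (D : Fin n → Obs d) :
    Feature d → Fin 2 :=
  plugInRule (etaStar β K h D)

end PlugIn

end

/-! Because the margin condition holds with $\alpha=\infty$, estimating $\eta$ to a fixed accuracy
is enough. At almost every $x$ either $\eta(x)=1/2$, where an error costs nothing, or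
$|\eta(x)-1/2|>t_0$, where an estimate within $t_0$ of $\eta(x)$ lands on the right side of $1/2$.
The bandwidth can therefore be frozen at one small value: the bias only has to fall below a
constant, and the fluctuations are those of finitely many empirical means of bounded functions, so
Hoeffding's inequality makes the failure probability exponentially small in $n$. Fubini turns the
pointwise bound into a bound on the excess risk (`excessRisk_le`).

Stability of the fit: the quadratic form of the design matrix has to dominate $\sum_s v_s^2$. Zero
sets of nonzero polynomials are null, and compactness of the unit sphere of coefficients makes this
uniform over sets filling a fixed proportion of a ball (`exists_sq_sum_le_setIntegral`). Regularity
of $A$, the bound $\mu\ge\mu_{\min}$ and $K\ge c$ near $0$ transfer it to $P$.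

Bias: the Hölder condition alone leaves the derivatives of $\eta$ uncontrolled, but $0\le\eta\le1$
almost everywhere on $A$. The Taylor polynomial at $x\in A$ is thus bounded on a thick set, so its
coefficients are bounded, and $\eta$ has a modulus of continuity depending only on the class
(`exists_modulus`). By dominated convergence the kernel-weighted modulus vanishes as $h\to0$.

These meet in a deterministic statement (`abs_eval_zero_sub_le`): the least squares fit is compared
with the constant polynomial $\eta(x)$, so no higher-order expansion of the bias is needed. The
eigenvalue test against $(\log n)^{-1}$ is passed once $n$ exceeds a constant; smaller $n$ are
absorbed into $C_4$. -/

noncomputable section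

namespace PlugIn

/-! ### Polynomials indexed by multi-indices -/

section Polynomials

variable {d l : ℕ}

/-- The monomial `u ^ s`. -/
def mono (s : MultiIndex d l) (u : Feature d) : ℝ := ∏ j, u j ^ (s.1 j : ℕ)

/-- The value at `u` of the polynomial with coefficients `v`. -/
def polyVal (v : MultiIndex d l → ℝ) (u : Feature d) : ℝ := ∑ s, v s * mono s u

/-- A multi-index as an exponent vector. -/
def expo (s : MultiIndex d l) : Fin d →₀ ℕ :=
  Finsupp.equivFunOnFinite.symm fun j => (s.1 j : ℕ)

/-- The multi-index `0`. -/
def zeroIndex (d l : ℕ) : MultiIndex d l := ⟨fun _ => 0, by simp⟩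

/-- The polynomial with coefficients `v`. -/
def toPoly (v : MultiIndex d l → ℝ) : MvPolynomial (Fin d) ℝ :=
  ∑ s, MvPolynomial.monomial (expo s) (v s)

theorem expo_injective : Function.Injective (expo : MultiIndex d l → Fin d →₀ ℕ) := by
  intro s t h
  ext j
  simpa [expo] using DFunLike.congr_fun h j

theorem degree_expo (s : MultiIndex d l) : (expo s).sum (fun _ e => e) = ∑ j, (s.1 j : ℕ) := by
  rw [Finsupp.sum_fintype _ _ (fun _ => rfl)]
  rfl

theorem eval_toPoly (v : MultiIndex d l → ℝ) (u : Feature d) :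
    MvPolynomial.eval (fun j => u j) (toPoly v) = polyVal v u := by
  simp only [toPoly, polyVal, map_sum, MvPolynomial.eval_monomial]
  refine Finset.sum_congr rfl fun s _ => ?_
  rw [Finsupp.prod_fintype _ _ (by simp)]
  rfl

theorem totalDegree_toPoly_le (v : MultiIndex d l → ℝ) : (toPoly v).totalDegree ≤ l := by
  refine MvPolynomial.totalDegree_finsetSum_le fun s _ => ?_
  refine (MvPolynomial.totalDegree_monomial_le _ _).trans ?_
  have := degree_expo s
  rw [show (Finsupp.sum (expo s) fun _ => id) = (expo s).sum (fun _ e => e) from rfl, this]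
  exact s.2

theorem coeff_toPoly (v : MultiIndex d l → ℝ) (s : MultiIndex d l) :
    MvPolynomial.coeff (expo s) (toPoly v) = v s := by
  classical
  simp [toPoly, MvPolynomial.coeff_sum, MvPolynomial.coeff_monomial, expo_injective.eq_iff]

theorem exists_expo_eq {m : Fin d →₀ ℕ} (hm : m.sum (fun _ e => e) ≤ l) :
    ∃ s : MultiIndex d l, expo s = m := by
  rw [Finsupp.sum_fintype _ _ (fun _ => rfl)] at hm
  have hj : ∀ j, m j < l + 1 := fun j => Nat.lt_succ_of_le
    ((Finset.single_le_sum (f := fun j => m j) (fun _ _ => Nat.zero_le _)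
      (Finset.mem_univ j)).trans hm)
  refine ⟨⟨fun j => ⟨m j, hj j⟩, hm⟩, ?_⟩
  ext j
  simp [expo]

theorem exists_toPoly_eq {θ : MvPolynomial (Fin d) ℝ} (hθ : θ.totalDegree ≤ l) :
    ∃ v : MultiIndex d l → ℝ, toPoly v = θ := by
  classical
  refine ⟨fun s => MvPolynomial.coeff (expo s) θ, ?_⟩
  ext m
  by_cases hm : m.sum (fun _ e => e) ≤ l
  · obtain ⟨s, rfl⟩ := exists_expo_eq hm
    rw [coeff_toPoly]
  · have h1 : ∀ p : MvPolynomial (Fin d) ℝ, p.totalDegree ≤ l → MvPolynomial.coeff m p = 0 := by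
      intro p hp
      by_contra hne
      exact hm ((MvPolynomial.le_totalDegree (MvPolynomial.mem_support_iff.2 hne)).trans hp)
    rw [h1 _ (totalDegree_toPoly_le _), h1 _ hθ]

theorem mono_smul (s : MultiIndex d l) (a : ℝ) (u : Feature d) :
    mono s (a • u) = a ^ (∑ j, (s.1 j : ℕ)) * mono s u := by
  simp [mono, mul_pow, Finset.prod_mul_distrib, Finset.prod_pow_eq_pow_sum]

/-- The polynomial `z ↦ polyVal v (h⁻¹ z)`. -/
def toPolyScaled (h : ℝ) (v : MultiIndex d l → ℝ) : MvPolynomial (Fin d) ℝ :=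
  toPoly fun s => v s * h⁻¹ ^ (∑ j, (s.1 j : ℕ))

theorem eval_toPolyScaled (h : ℝ) (v : MultiIndex d l → ℝ) (z : Feature d) :
    MvPolynomial.eval (fun j => z j) (toPolyScaled h v) = polyVal v (h⁻¹ • z) := by
  simp [toPolyScaled, eval_toPoly, polyVal, mono_smul, mul_assoc]

/-- The criterion uses $X_i-x$ while the design matrix uses $(X_i-x)/h$. For $h\ne0$ rescaling the
coefficients by powers of $h$ is onto, so minimizing over polynomials of degree at most $l$ is
minimizing over scaled coefficient vectors. -/
theorem exists_toPolyScaled_eq {h : ℝ} (hh : h ≠ 0) {θ : MvPolynomial (Fin d) ℝ}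
    (hθ : θ.totalDegree ≤ l) : ∃ v : MultiIndex d l → ℝ, toPolyScaled h v = θ := by
  obtain ⟨w, rfl⟩ := exists_toPoly_eq hθ
  refine ⟨fun s => w s * h ^ (∑ j, (s.1 j : ℕ)), ?_⟩
  simp [toPolyScaled, hh]

theorem mono_zero (s : MultiIndex d l) :
    mono s (0 : Feature d) = if s = zeroIndex d l then 1 else 0 := by
  split_ifs with hs
  · simp [hs, mono, zeroIndex]
  · have : ∃ j, s.1 j ≠ 0 := by
      by_contra! hc
      exact hs (Subtype.ext (funext hc))
    obtain ⟨j, hj⟩ := this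
    refine Finset.prod_eq_zero (Finset.mem_univ j) ?_
    have : (s.1 j : ℕ) ≠ 0 := fun h => hj (Fin.ext h)
    simp [this]

theorem polyVal_zero (v : MultiIndex d l → ℝ) : polyVal v 0 = v (zeroIndex d l) := by
  simp [polyVal, mono_zero]

theorem mono_zeroIndex (u : Feature d) : mono (zeroIndex d l) u = 1 := by
  simp [mono, zeroIndex]

theorem abs_mono_le (s : MultiIndex d l) (u : Feature d) :
    |mono s u| ≤ ‖u‖ ^ (∑ j, (s.1 j : ℕ)) := by
  rw [mono, Finset.abs_prod, ← Finset.prod_pow_eq_pow_sum]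
  refine Finset.prod_le_prod (fun _ _ => abs_nonneg _) fun j _ => ?_
  rw [abs_pow]
  exact pow_le_pow_left₀ (abs_nonneg _) (by simpa using PiLp.norm_apply_le u j) _

theorem continuous_mono (s : MultiIndex d l) : Continuous (mono s : Feature d → ℝ) := by
  unfold mono
  fun_prop

theorem continuous_polyVal (v : MultiIndex d l → ℝ) :
    Continuous (polyVal v : Feature d → ℝ) :=
  continuous_finsetSum _ fun s _ => continuous_const.mul (continuous_mono s)

theorem polyVal_sub (v w : MultiIndex d l → ℝ) (u : Feature d) :
    polyVal (v - w) u = polyVal v u - polyVal w u := by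
  simp [polyVal, sub_mul]

theorem polyVal_smul (a : ℝ) (v : MultiIndex d l → ℝ) (u : Feature d) :
    polyVal (a • v) u = a * polyVal v u := by
  simp [polyVal, Finset.mul_sum, mul_assoc]

theorem sq_polyVal (v : MultiIndex d l → ℝ) (u : Feature d) :
    polyVal v u ^ 2 = ∑ s, ∑ t, v s * v t * (mono s u * mono t u) := by
  rw [sq, polyVal, Finset.sum_mul_sum]
  exact Finset.sum_congr rfl fun s _ => Finset.sum_congr rfl fun t _ => by ring

end Polynomials

/-! ### Zero sets of polynomials are null -/

/-- Induction on the dimension: as a polynomial in the first variable, $p$ has a nonzero leading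
coefficient, which by induction vanishes only on a null set of the other variables. Elsewhere the
one-variable slice has finitely many roots, and Fubini concludes. -/
theorem ae_eval_ne_zero : ∀ (d : ℕ) {p : MvPolynomial (Fin d) ℝ}, p ≠ 0 →
    ∀ᵐ x : Fin d → ℝ, MvPolynomial.eval x p ≠ 0 := by
  intro d
  induction d with
  | zero =>
    intro p hp
    refine Filter.Eventually.of_forall fun x hx => hp ?_
    rw [MvPolynomial.eq_C_of_isEmpty p] at hx ⊢
    simp only [MvPolynomial.eval_C] at hx
    rw [hx, map_zero]
  | succ d ih =>
    intro p hp
    set q := MvPolynomial.finSuccEquiv ℝ d p with hq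
    have hq0 : q ≠ 0 := by simpa [hq] using hp
    have hmeas : MeasurableSet {x : Fin (d + 1) → ℝ | MvPolynomial.eval x p ≠ 0} :=
      (isOpen_ne_fun (MvPolynomial.continuous_eval p) continuous_const).measurableSet
    have hmp := (volume_preserving_piFinSuccAbove (fun _ : Fin (d + 1) => ℝ) 0).symm
    rw [← hmp.map_eq, ae_map_iff hmp.measurable.aemeasurable hmeas]
    have hm2 : MeasurableSet {z : ℝ × (Fin d → ℝ) | MvPolynomial.eval
        ((MeasurableEquiv.piFinSuccAbove (fun _ : Fin (d + 1) => ℝ) 0).symm z) p ≠ 0} :=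
      hmp.measurable hmeas
    have hsw : ∀ᵐ y : (Fin d → ℝ), ∀ᵐ t : ℝ, MvPolynomial.eval
        ((MeasurableEquiv.piFinSuccAbove (fun _ : Fin (d + 1) => ℝ) 0).symm (t, y)) p ≠ 0 := by
      filter_upwards [ih (Polynomial.leadingCoeff_ne_zero.2 hq0)] with y hy
      have hmap : q.map (MvPolynomial.eval y) ≠ 0 := by
        intro h0
        apply hy
        have := congrArg (fun r => r.coeff q.natDegree) h0
        simpa using this
      have hfin : {t : ℝ | (q.map (MvPolynomial.eval y)).IsRoot t}.Finite :=
        Polynomial.finite_setOfPred_isRoot hmap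
      filter_upwards [hfin.countable.ae_notMem volume] with t ht h0
      apply ht
      have h1 := MvPolynomial.eval_eq_eval_mv_eval' y t p
      have h2 : (MeasurableEquiv.piFinSuccAbove (fun _ : Fin (d + 1) => ℝ) 0).symm (t, y)
          = (Fin.cons t y : Fin (d + 1) → ℝ) := by
        simp [MeasurableEquiv.piFinSuccAbove]
        rfl
      rw [h2, h1] at h0
      exact h0
    rw [Measure.volume_eq_prod, Measure.ae_prod_iff_ae_ae hm2]
    exact (Measure.ae_ae_comm (p := fun (t : ℝ) (y : Fin d → ℝ) => MvPolynomial.eval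
        ((MeasurableEquiv.piFinSuccAbove (fun _ : Fin (d + 1) => ℝ) 0).symm (t, y)) p ≠ 0) hm2).2 hsw

theorem ae_polyVal_ne_zero {d l : ℕ} {v : MultiIndex d l → ℝ} (hv : v ≠ 0) :
    ∀ᵐ u : Feature d, polyVal v u ≠ 0 := by
  have hp : toPoly v ≠ 0 := by
    intro h
    apply hv
    ext s
    rw [← coeff_toPoly v s, h]
    simp
  have := (PiLp.volume_preserving_ofLp (Fin d)).quasiMeasurePreserving.ae
    (ae_eval_ne_zero d hp)
  filter_upwards [this] with u hu
  rwa [← eval_toPoly]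

/-! ### Lower bounds for polynomials on thick sets -/

section Thick

variable {d l : ℕ}

/-- Continuity of measure from above: the sublevel sets decrease to the null zero set, and the ball
keeps their volumes finite. -/
theorem exists_volume_small_lt {v : MultiIndex d l → ℝ} (hv : v ≠ 0) (R : ℝ) {m : ENNReal}
    (hm : 0 < m) :
    ∃ ε : ℝ, 0 < ε ∧ volume {u : Feature d | u ∈ Metric.closedBall 0 R ∧ |polyVal v u| ≤ ε} < m := by
  set T : ℕ → Set (Feature d) := fun k =>
    {u | u ∈ Metric.closedBall 0 R ∧ |polyVal v u| ≤ 1 / ((k : ℝ) + 1)} with hT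
  have hmeas : ∀ k, MeasurableSet (T k) := fun k =>
    Metric.isClosed_closedBall.measurableSet.inter
      (isClosed_le (continuous_polyVal v).abs continuous_const).measurableSet
  have hanti : Antitone T := fun i j hij u hu =>
    ⟨hu.1, hu.2.trans (one_div_le_one_div_of_le (by positivity) (by exact_mod_cast by lia))⟩
  have hfin : ∃ k, volume (T k) ≠ ⊤ := ⟨0, ((measure_mono fun u hu => hu.1).trans_lt
    (measure_closedBall_lt_top (x := (0 : Feature d)) (r := R))).ne⟩
  have hlim := tendsto_measure_iInter_atTop (fun k => (hmeas k).nullMeasurableSet) hanti hfin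
  have hzero : volume (⋂ k, T k) = 0 := by
    refine measure_mono_null ?_ (ae_polyVal_ne_zero hv)
    intro u hu
    simp only [Set.mem_compl_iff, Set.mem_ofPred_eq, not_not]
    by_contra hne
    obtain ⟨k, hk⟩ := exists_nat_one_div_lt (abs_pos.2 hne)
    exact absurd (Set.mem_iInter.1 hu k).2 (not_le.2 hk)
  rw [hzero] at hlim
  obtain ⟨k, hk⟩ := (hlim.eventually (gt_mem_nhds hm)).exists
  exact ⟨1 / ((k : ℝ) + 1), by positivity, hk⟩

theorem abs_mono_le_of_norm_le (s : MultiIndex d l) {u : Feature d} {R : ℝ} (hu : ‖u‖ ≤ R) :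
    |mono s u| ≤ max 1 R ^ l := by
  have h1 : (1 : ℝ) ≤ max 1 R := le_max_left _ _
  calc |mono s u| ≤ ‖u‖ ^ (∑ j, (s.1 j : ℕ)) := abs_mono_le s u
    _ ≤ max 1 R ^ (∑ j, (s.1 j : ℕ)) :=
        pow_le_pow_left₀ (norm_nonneg _) (hu.trans (le_max_right _ _)) _
    _ ≤ max 1 R ^ l := pow_le_pow_right₀ h1 s.2

theorem abs_polyVal_le (v : MultiIndex d l → ℝ) {u : Feature d} {R : ℝ} (hu : ‖u‖ ≤ R) :
    |polyVal v u| ≤ ‖v‖ * (Fintype.card (MultiIndex d l) * max 1 R ^ l) := by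
  calc |polyVal v u| ≤ ∑ s, |v s * mono s u| := Finset.abs_sum_le_sum_abs _ _
    _ ≤ ∑ _s : MultiIndex d l, ‖v‖ * max 1 R ^ l := by
        refine Finset.sum_le_sum fun s _ => ?_
        rw [abs_mul]
        exact mul_le_mul (norm_le_pi_norm v s) (abs_mono_le_of_norm_le s hu) (abs_nonneg _)
          (norm_nonneg _)
    _ = _ := by simp; ring

theorem exists_uniform_volume_small_lt (d l : ℕ) (R : ℝ) {m : ENNReal} (hm : 0 < m) :
    ∃ ε : ℝ, 0 < ε ∧ ∀ v : MultiIndex d l → ℝ, ‖v‖ = 1 →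
      volume {u : Feature d | u ∈ Metric.closedBall 0 R ∧ |polyVal v u| ≤ ε} < m := by
  have hcomp : IsCompact (Metric.sphere (0 : MultiIndex d l → ℝ) 1) := isCompact_sphere _ _
  set B : ℝ := Fintype.card (MultiIndex d l) * max 1 R ^ l with hB
  have hB0 : 0 ≤ B := by positivity
  have hmono : ∀ (v : MultiIndex d l → ℝ) {ε ε' : ℝ}, ε ≤ ε' →
      {u : Feature d | u ∈ Metric.closedBall 0 R ∧ |polyVal v u| ≤ ε} ⊆
        {u : Feature d | u ∈ Metric.closedBall 0 R ∧ |polyVal v u| ≤ ε'} :=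
    fun v ε ε' hε u hu => ⟨hu.1, hu.2.trans hε⟩
  suffices H : ∃ ε : ℝ, 0 < ε ∧ ∀ v ∈ Metric.sphere (0 : MultiIndex d l → ℝ) 1,
      volume {u : Feature d | u ∈ Metric.closedBall 0 R ∧ |polyVal v u| ≤ ε} < m by
    obtain ⟨ε, h0, h⟩ := H
    exact ⟨ε, h0, fun v hv => h v (by simpa using hv)⟩
  refine hcomp.induction_on (p := fun s => ∃ ε : ℝ, 0 < ε ∧ ∀ v ∈ s,
      volume {u : Feature d | u ∈ Metric.closedBall 0 R ∧ |polyVal v u| ≤ ε} < m)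
    ⟨1, one_pos, by simp⟩ ?_ ?_ ?_
  · rintro s t hst ⟨ε, h0, h⟩
    exact ⟨ε, h0, fun v hv => h v (hst hv)⟩
  · rintro s t ⟨ε, h0, h⟩ ⟨ε', h0', h'⟩
    refine ⟨min ε ε', lt_min h0 h0', ?_⟩
    rintro v (hv | hv)
    · exact (measure_mono (hmono v (min_le_left _ _))).trans_lt (h v hv)
    · exact (measure_mono (hmono v (min_le_right _ _))).trans_lt (h' v hv)
  · intro v hv
    have hv0 : v ≠ 0 := by
      rintro rfl
      simp at hv
    obtain ⟨ε, h0, h⟩ := exists_volume_small_lt hv0 R hm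
    -- Halving `ε` leaves room for the perturbation: on the ball of radius `R` the values at `v` and
    -- at a nearby `w` differ by at most `‖v - w‖ * B ≤ ε / 2`.
    refine ⟨Metric.ball v (ε / 2 / (B + 1)),
      mem_nhdsWithin_of_mem_nhds (Metric.ball_mem_nhds v (by positivity)), ε / 2, by positivity, ?_⟩
    intro w hw
    have hsub : {u : Feature d | u ∈ Metric.closedBall 0 R ∧ |polyVal w u| ≤ ε / 2} ⊆
        {u : Feature d | u ∈ Metric.closedBall 0 R ∧ |polyVal v u| ≤ ε} := by
      intro u hu
      refine ⟨hu.1, ?_⟩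
      have h1 := abs_polyVal_le (v - w) (u := u) (R := R) (by simpa using hu.1)
      rw [polyVal_sub] at h1
      have h2 : ‖v - w‖ * B ≤ ε / 2 := by
        have h3 : ‖v - w‖ < ε / 2 / (B + 1) := by
          rw [← dist_eq_norm, dist_comm]
          exact hw
        rw [lt_div_iff₀ (by positivity)] at h3
        nlinarith [norm_nonneg (v - w)]
      have h4 := abs_sub_abs_le_abs_sub (polyVal v u) (polyVal w u)
      have h5 := hu.2
      linarith
    exact (measure_mono hsub).trans_lt h

/-- On subsets of a ball which fill at least a fixed proportion of it, the `L²` norm of a polynomial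
dominates the norm of its coefficients. -/
theorem exists_sq_sum_le_setIntegral (d l : ℕ) {R c₀ : ℝ} (hR : 0 < R) (hc₀ : 0 < c₀) :
    ∃ κ : ℝ, 0 < κ ∧ ∀ (v : MultiIndex d l → ℝ) (S : Set (Feature d)), MeasurableSet S →
      S ⊆ Metric.closedBall 0 R →
      ENNReal.ofReal c₀ * volume (Metric.closedBall (0 : Feature d) R) ≤ volume S →
      κ * ∑ s, v s ^ 2 ≤ ∫ u in S, polyVal v u ^ 2 := by
  set V : ENNReal := ENNReal.ofReal c₀ * volume (Metric.closedBall (0 : Feature d) R) with hV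
  have hVpos : 0 < V := ENNReal.mul_pos (by simpa using hc₀)
    (Metric.measure_closedBall_pos volume _ hR).ne'
  have hVtop : V ≠ ⊤ := ENNReal.mul_ne_top ENNReal.ofReal_ne_top
    (measure_closedBall_lt_top (x := (0 : Feature d)) (r := R)).ne
  have hm : 0 < V / 2 := ENNReal.half_pos hVpos.ne'
  have hmtop : V / 2 ≠ ⊤ := (ENNReal.half_lt_self hVpos.ne' hVtop).ne_top
  obtain ⟨ε, hε, H⟩ := exists_uniform_volume_small_lt d l R hm
  have hNpos : (0 : ℝ) < Fintype.card (MultiIndex d l) := by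
    exact_mod_cast Fintype.card_pos_iff.2 ⟨zeroIndex d l⟩
  have hmr : 0 < (V / 2).toReal := ENNReal.toReal_pos hm.ne' hmtop
  refine ⟨ε ^ 2 * (V / 2).toReal / Fintype.card (MultiIndex d l), by positivity, ?_⟩
  have key : ∀ (v : MultiIndex d l → ℝ) (S : Set (Feature d)), MeasurableSet S →
      S ⊆ Metric.closedBall 0 R → V ≤ volume S → ‖v‖ = 1 →
      ε ^ 2 * (V / 2).toReal ≤ ∫ u in S, polyVal v u ^ 2 := by
    intro v S hS hSR hVS hv
    set T : Set (Feature d) := {u | u ∈ Metric.closedBall 0 R ∧ |polyVal v u| ≤ ε} with hT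
    have hTm : MeasurableSet T := Metric.isClosed_closedBall.measurableSet.inter
      (isClosed_le (continuous_polyVal v).abs continuous_const).measurableSet
    have hSfin : volume S ≠ ⊤ := ((measure_mono hSR).trans_lt
      (measure_closedBall_lt_top (x := (0 : Feature d)) (r := R))).ne
    -- The set where the polynomial is small occupies less than half of the guaranteed volume `V`,
    -- so at least `V / 2` of `S` remains.
    have hvol : V / 2 ≤ volume (S \ T) := by
      have h1 : volume S ≤ volume (S \ T) + volume T := by
        rw [← measure_inter_add_sdiff S hTm, add_comm]
        gcongr
        exact Set.inter_subset_right
      have h2 : V / 2 + V / 2 ≤ volume (S \ T) + V / 2 := by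
        rw [ENNReal.add_halves]
        exact hVS.trans (h1.trans (by gcongr; exact (H v hv).le))
      exact (ENNReal.add_le_add_iff_right hmtop).1 h2
    have hint : IntegrableOn (fun u => polyVal v u ^ 2) S :=
      (((continuous_polyVal v).pow 2).continuousOn.integrableOn_compact
        (isCompact_closedBall (0 : Feature d) R)).mono_set hSR
    calc ε ^ 2 * (V / 2).toReal ≤ ε ^ 2 * volume.real (S \ T) := by
          gcongr
          exact ENNReal.toReal_mono ((measure_mono Set.sdiff_subset).trans_lt hSfin.lt_top).ne hvol
      _ = ∫ _u in S \ T, ε ^ 2 := by simp [mul_comm]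
      _ ≤ ∫ u in S \ T, polyVal v u ^ 2 := by
          refine setIntegral_mono_on ?_ (hint.mono_set Set.sdiff_subset) (hS.diff hTm) ?_
          · exact integrableOn_const ((measure_mono Set.sdiff_subset).trans_lt hSfin.lt_top).ne
          · intro u hu
            have : ε < |polyVal v u| := by
              by_contra hc
              exact hu.2 ⟨hSR hu.1, not_lt.1 hc⟩
            rw [← sq_abs (polyVal v u)]
            gcongr
      _ ≤ ∫ u in S, polyVal v u ^ 2 :=
          setIntegral_mono_set hint (Filter.Eventually.of_forall fun u => sq_nonneg _)
            Set.sdiff_subset.eventuallyLE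
  intro v S hS hSR hVS
  by_cases hv : v = 0
  · subst hv
    simpa using integral_nonneg (μ := volume.restrict S) fun u => sq_nonneg (polyVal 0 u)
  have hvn : 0 < ‖v‖ := norm_pos_iff.2 hv
  have h1 := key (‖v‖⁻¹ • v) S hS hSR hVS (by rw [norm_smul, norm_inv, norm_norm]; field_simp)
  simp only [polyVal_smul, mul_pow, integral_const_mul] at h1
  have h2 : ∑ s, v s ^ 2 ≤ Fintype.card (MultiIndex d l) * ‖v‖ ^ 2 := by
    calc ∑ s, v s ^ 2 ≤ ∑ _s : MultiIndex d l, ‖v‖ ^ 2 := by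
          refine Finset.sum_le_sum fun s _ => ?_
          rw [← sq_abs (v s)]
          exact pow_le_pow_left₀ (abs_nonneg _) (norm_le_pi_norm v s) 2
      _ = _ := by simp
  have h3 : ε ^ 2 * (V / 2).toReal * ‖v‖ ^ 2 ≤ ∫ u in S, polyVal v u ^ 2 := by
    rw [inv_pow, inv_mul_eq_div, le_div_iff₀ (by positivity)] at h1
    exact h1
  refine le_trans ?_ h3
  rw [div_mul_eq_mul_div, div_le_iff₀ hNpos]
  calc ε ^ 2 * (V / 2).toReal * ∑ s, v s ^ 2
      ≤ ε ^ 2 * (V / 2).toReal * (Fintype.card (MultiIndex d l) * ‖v‖ ^ 2) := by gcongr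
    _ = _ := by ring

end Thick

/-! ### The smallest eigenvalue -/

section MinEigenvalue

open Matrix

variable {ι : Type} [Fintype ι]

theorem dotProduct_mulVec_eq_sum (M : Matrix ι ι ℝ) (v : ι → ℝ) :
    v ⬝ᵥ M *ᵥ v = ∑ s, ∑ t, v s * v t * M s t := by
  simp only [dotProduct, mulVec, Finset.mul_sum]
  exact Finset.sum_congr rfl fun s _ => Finset.sum_congr rfl fun t _ => by ring

variable [DecidableEq ι]

/-- The Rayleigh characterization. It reduces every later use of the eigenvalue to an inequality
between quadratic forms. -/
theorem le_minEigenvalue_iff [Nonempty ι] {M : Matrix ι ι ℝ} (hM : M.IsHermitian) (t : ℝ) :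
    t ≤ minEigenvalue M ↔ ∀ v : ι → ℝ, t * ∑ s, v s ^ 2 ≤ v ⬝ᵥ M *ᵥ v := by
  have hspec := hM.spectrum_real_eq_range_eigenvalues
  have hsq : ∀ v : ι → ℝ, v ⬝ᵥ v = ∑ s, v s ^ 2 := fun v => by simp [dotProduct, sq]
  constructor
  · intro ht v
    have hps : (M - algebraMap ℝ (Matrix ι ι ℝ) t).PosSemidef := by
      rw [posSemidef_iff_isHermitian_and_spectrum_nonneg]
      constructor
      · refine hM.sub ?_
        rw [Algebra.algebraMap_eq_smul_one]
        simp [IsHermitian]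
      · intro a ha
        rw [← spectrum.sub_singleton_eq] at ha
        obtain ⟨b, hb, c, hc, rfl⟩ := ha
        rw [Set.mem_singleton_iff] at hc
        subst hc
        have : c ≤ b := ht.trans (csInf_le (finite_real_spectrum (A := M)).bddBelow hb)
        simpa using this
    have h := hps.dotProduct_mulVec_nonneg v
    rw [Algebra.algebraMap_eq_smul_one, sub_mulVec, dotProduct_sub, smul_mulVec, one_mulVec,
      dotProduct_smul] at h
    simp only [star_trivial, smul_eq_mul, hsq] at h
    linarith
  · intro h
    refine le_csInf ?_ ?_
    · rw [hspec]
      exact Set.range_nonempty _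
    · rw [hspec]
      rintro _ ⟨i, rfl⟩
      have h1 := h (hM.eigenvectorBasis i).ofLp
      rw [hM.mulVec_eigenvectorBasis, dotProduct_smul, hsq, smul_eq_mul] at h1
      refine le_of_mul_le_mul_right h1 ?_
      have : ‖hM.eigenvectorBasis i‖ ^ 2 = 1 := by simp
      rw [EuclideanSpace.norm_sq_eq] at this
      simp only [Real.norm_eq_abs, sq_abs] at this
      rw [this]
      exact one_pos

theorem posDef_of_minEigenvalue_pos [Nonempty ι] {M : Matrix ι ι ℝ} (hM : M.IsHermitian)
    (h : 0 < minEigenvalue M) : M.PosDef := by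
  refine PosDef.of_dotProduct_mulVec_pos hM fun v hv => ?_
  have h1 := (le_minEigenvalue_iff hM _).1 le_rfl v
  have h2 : 0 < ∑ s, v s ^ 2 := by
    obtain ⟨s, hs⟩ := Function.ne_iff.1 hv
    exact Finset.sum_pos' (fun _ _ => sq_nonneg _) ⟨s, Finset.mem_univ s,
      by simpa using sq_pos_of_ne_zero hs⟩
  rw [star_trivial]
  exact (mul_pos h h2).trans_le h1

theorem measurable_minEigenvalue [Nonempty ι] {α : Type*} [MeasurableSpace α]
    {M : α → Matrix ι ι ℝ} (hM : ∀ a, (M a).IsHermitian)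
    (hmeas : ∀ s t, Measurable fun a => M a s t) : Measurable fun a => minEigenvalue (M a) := by
  refine measurable_of_Ici fun t => ?_
  have hm : Measurable (fun a s t => M a s t : α → ι → ι → ℝ) :=
    measurable_pi_lambda _ fun s => measurable_pi_lambda _ fun t => hmeas s t
  -- The intersection over `v` is uncountable, but each condition is closed in the matrix entries,
  -- so the superlevel set is closed and hence Borel.
  have hcl : IsClosed {N : ι → ι → ℝ | ∀ v : ι → ℝ,
      t * ∑ s, v s ^ 2 ≤ ∑ s, ∑ r, v s * v r * N s r} := by
    rw [Set.ofPred_forall]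
    exact isClosed_iInter fun v => isClosed_le continuous_const (by fun_prop)
  convert hm hcl.measurableSet using 1
  ext a
  simp only [Set.mem_preimage, Set.mem_Ici, le_minEigenvalue_iff (hM a), dotProduct_mulVec_eq_sum]
  rfl

theorem measurable_det {α : Type*} [MeasurableSpace α] {M : α → Matrix ι ι ℝ}
    (hmeas : ∀ s t, Measurable fun a => M a s t) : Measurable fun a => (M a).det := by
  simp only [det_apply]
  exact Finset.measurable_fun_sum _ fun σ _ =>
    (Finset.measurable_fun_prod _ fun i _ => hmeas _ _).const_smul _

theorem measurable_inv_apply {α : Type*} [MeasurableSpace α] {M : α → Matrix ι ι ℝ}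
    (hmeas : ∀ s t, Measurable fun a => M a s t) (i j : ι) :
    Measurable fun a => (M a)⁻¹ i j := by
  simp only [inv_def, Matrix.smul_apply, adjugate_apply, smul_eq_mul, Ring.inverse_eq_inv']
  refine (measurable_det hmeas).inv.mul (measurable_det fun s t => ?_)
  by_cases hs : s = j
  · subst hs
    simp only [updateRow_self]
    exact measurable_const
  · simpa [updateRow_ne hs] using hmeas s t

end MinEigenvalue

/-! ### The locally polynomial estimator -/

section Estimator

open Matrix

variable {d n l : ℕ} {K : Feature d → ℝ} {h : ℝ}

instance (d l : ℕ) : Nonempty (MultiIndex d l) := ⟨zeroIndex d l⟩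

theorem designMatrix_apply (D : Fin n → Obs d) (x : Feature d) (s t : MultiIndex d l) :
    designMatrix l K h D x s t = ((n : ℝ) * h ^ d)⁻¹ * ∑ i,
      mono s (h⁻¹ • ((D i).1 - x)) * mono t (h⁻¹ • ((D i).1 - x)) * K (h⁻¹ • ((D i).1 - x)) := by
  simp only [designMatrix, mono, pow_add, Finset.prod_mul_distrib]

theorem isHermitian_designMatrix (D : Fin n → Obs d) (x : Feature d) :
    (designMatrix l K h D x).IsHermitian := by
  ext s t
  simp only [conjTranspose_apply, star_trivial, designMatrix_apply]
  congr 1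
  exact Finset.sum_congr rfl fun i _ => by ring

theorem dotProduct_designMatrix_mulVec (D : Fin n → Obs d) (x : Feature d)
    (v : MultiIndex d l → ℝ) :
    v ⬝ᵥ designMatrix l K h D x *ᵥ v = ((n : ℝ) * h ^ d)⁻¹ *
      ∑ i, polyVal v (h⁻¹ • ((D i).1 - x)) ^ 2 * K (h⁻¹ • ((D i).1 - x)) := by
  rw [dotProduct_mulVec_eq_sum]
  simp only [designMatrix_apply, sq_polyVal, Finset.sum_mul]
  simp only [Finset.mul_sum]
  rw [Finset.sum_comm (s := (Finset.univ : Finset (Fin n)))]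
  refine Finset.sum_congr rfl fun s _ => ?_
  rw [Finset.sum_comm (s := (Finset.univ : Finset (Fin n)))]
  exact Finset.sum_congr rfl fun t _ => Finset.sum_congr rfl fun i _ => by ring

/-- The right-hand side `(n h^d)⁻¹ ∑ᵢ Yᵢ ((Xᵢ-x)/h)^s K((Xᵢ-x)/h)` of the normal equations. -/
def designVector (l : ℕ) (K : Feature d → ℝ) (h : ℝ) (D : Fin n → Obs d) (x : Feature d) :
    MultiIndex d l → ℝ :=
  fun s => ((n : ℝ) * h ^ d)⁻¹ * ∑ i, ((((D i).2 : ℕ) : ℝ) * mono s (h⁻¹ • ((D i).1 - x))) *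
    K (h⁻¹ • ((D i).1 - x))

theorem lpCriterion_toPolyScaled (hn : 0 < n) (hh : 0 < h) (D : Fin n → Obs d) (x : Feature d)
    (v : MultiIndex d l → ℝ) :
    lpCriterion K h D x (toPolyScaled h v) =
      (∑ i, (((D i).2 : ℕ) : ℝ) ^ 2 * K (h⁻¹ • ((D i).1 - x))) +
      (n * h ^ d) * (v ⬝ᵥ designMatrix l K h D x *ᵥ v - 2 * (v ⬝ᵥ designVector l K h D x)) := by
  have hne : (n : ℝ) * h ^ d ≠ 0 := by positivity
  have h2 : v ⬝ᵥ designVector l K h D x = ((n : ℝ) * h ^ d)⁻¹ * ∑ i, (((D i).2 : ℕ) : ℝ) *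
      polyVal v (h⁻¹ • ((D i).1 - x)) * K (h⁻¹ • ((D i).1 - x)) := by
    simp only [dotProduct, designVector, polyVal, Finset.mul_sum, Finset.sum_mul]
    rw [Finset.sum_comm]
    refine Finset.sum_congr rfl fun s _ => Finset.sum_congr rfl fun i _ => by ring
  rw [dotProduct_designMatrix_mulVec, h2, mul_sub, mul_inv_cancel_left₀ hne, mul_left_comm,
    mul_inv_cancel_left₀ hne, Finset.mul_sum, ← Finset.sum_sub_distrib, ← Finset.sum_add_distrib]
  refine Finset.sum_congr rfl fun i _ => ?_
  rw [eval_toPolyScaled]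
  ring

theorem totalDegree_toPolyScaled_le (v : MultiIndex d l → ℝ) :
    (toPolyScaled h v).totalDegree ≤ l := totalDegree_toPoly_le _

/-- Completing the square around a solution of the normal equations. With a positive definite design
matrix this gives both existence and uniqueness of the minimizer. -/
theorem lpCriterion_sub_eq (hn : 0 < n) (hh : 0 < h) (D : Fin n → Obs d) (x : Feature d)
    (v w : MultiIndex d l → ℝ) (hw : designMatrix l K h D x *ᵥ w = designVector l K h D x) :
    lpCriterion K h D x (toPolyScaled h v) = lpCriterion K h D x (toPolyScaled h w) +
      (n * h ^ d) * ((v - w) ⬝ᵥ designMatrix l K h D x *ᵥ (v - w)) := by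
  rw [lpCriterion_toPolyScaled hn hh, lpCriterion_toPolyScaled hn hh, ← hw]
  have hsymm : w ⬝ᵥ designMatrix l K h D x *ᵥ v = v ⬝ᵥ designMatrix l K h D x *ᵥ w := by
    have hT : (designMatrix l K h D x)ᵀ = designMatrix l K h D x := by
      have := isHermitian_designMatrix (l := l) (K := K) (h := h) D x
      rwa [IsHermitian, conjTranspose_eq_transpose_of_trivial] at this
    rw [dotProduct_mulVec, ← mulVec_transpose, hT, dotProduct_comm]
  rw [mulVec_sub, dotProduct_sub, sub_dotProduct, sub_dotProduct, hsymm]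
  ring

theorem existsUnique_isLPMinimizer (hn : 0 < n) (hh : 0 < h) (D : Fin n → Obs d) (x : Feature d)
    (hpos : 0 < minEigenvalue (designMatrix l K h D x)) :
    (∃! θ : MvPolynomial (Fin d) ℝ, IsLPMinimizer l K h D x θ) ∧
      IsLPMinimizer l K h D x
        (toPolyScaled h ((designMatrix l K h D x)⁻¹ *ᵥ designVector l K h D x)) := by
  have hpd := posDef_of_minEigenvalue_pos (isHermitian_designMatrix D x) hpos
  set w := (designMatrix l K h D x)⁻¹ *ᵥ designVector l K h D x with hwdef
  have hw : designMatrix l K h D x *ᵥ w = designVector l K h D x := by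
    rw [hwdef, mulVec_mulVec, mul_nonsing_inv _ ((isUnit_iff_isUnit_det _).1 hpd.isUnit),
      one_mulVec]
  have hc : (0 : ℝ) < n * h ^ d := by positivity
  have hmin : IsLPMinimizer l K h D x (toPolyScaled h w) := by
    refine ⟨totalDegree_toPolyScaled_le _, fun θ' hθ' => ?_⟩
    obtain ⟨v, rfl⟩ := exists_toPolyScaled_eq hh.ne' hθ'
    rw [lpCriterion_sub_eq hn hh D x v w hw]
    have := hpd.posSemidef.dotProduct_mulVec_nonneg (v - w)
    rw [star_trivial] at this
    nlinarith
  refine ⟨⟨_, hmin, fun θ hθ => ?_⟩, hmin⟩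
  obtain ⟨v, rfl⟩ := exists_toPolyScaled_eq hh.ne' hθ.1
  have h1 := hθ.2 _ hmin.1
  rw [lpCriterion_sub_eq hn hh D x v w hw] at h1
  have h2 : v - w = 0 := by
    by_contra hne
    have := hpd.dotProduct_mulVec_pos hne
    rw [star_trivial] at this
    nlinarith
  rw [sub_eq_zero.1 h2]

theorem lpEstimator_eq (hn : 0 < n) (hh : 0 < h) (D : Fin n → Obs d) (x : Feature d)
    (hpos : 0 < minEigenvalue (designMatrix l K h D x)) :
    lpEstimator l K h D x =
      ((designMatrix l K h D x)⁻¹ *ᵥ designVector l K h D x) (zeroIndex d l) := by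
  obtain ⟨H, hmin⟩ := existsUnique_isLPMinimizer hn hh D x hpos
  rw [lpEstimator, dif_pos H, H.unique H.choose_spec.1 hmin]
  have := eval_toPolyScaled h ((designMatrix l K h D x)⁻¹ *ᵥ designVector l K h D x) (0 : Feature d)
  rw [smul_zero, polyVal_zero] at this
  exact this

/-- Measurability is not visible from a chosen unique minimizer. Since $\log n\ge0$, passing the
eigenvalue test forces a positive smallest eigenvalue, so the choice can be replaced by the explicit
solution $\bar\Omega^{-1}b$, with $b$ the design vector. -/
theorem etaStar_eq {β : ℝ} (hn : 0 < n) (hh : 0 < h) (D : Fin n → Obs d) (x : Feature d) :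
    etaStar β K h D x =
      open Classical in
      if 1 < minEigenvalue (designMatrix (lfloor β) K h D x) * Real.log n then
        max 0 (min 1 (((designMatrix (lfloor β) K h D x)⁻¹ *ᵥ
          designVector (lfloor β) K h D x) (zeroIndex d (lfloor β))))
      else 0 := by
  rw [etaStar]
  split_ifs with hc
  · rw [lpEstimator_eq hn hh D x]
    by_contra hneg
    have : minEigenvalue (designMatrix (lfloor β) K h D x) * Real.log n ≤ 0 :=
      mul_nonpos_of_nonpos_of_nonneg (not_lt.1 hneg) (Real.log_natCast_nonneg n)
    linarith
  · rfl

theorem measurable_plugInClassifier {β : ℝ} (hK : Measurable K) (hn : 0 < n) (hh : 0 < h) :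
    Measurable fun p : (Fin n → Obs d) × Feature d => plugInClassifier β K h p.1 p.2 := by
  have hX : ∀ i, Measurable fun p : (Fin n → Obs d) × Feature d => h⁻¹ • ((p.1 i).1 - p.2) :=
    fun i => by fun_prop
  have hY : ∀ i, Measurable fun p : (Fin n → Obs d) × Feature d => (((p.1 i).2 : ℕ) : ℝ) :=
    fun i => (measurable_of_countable fun y : Fin 2 => ((y : ℕ) : ℝ)).comp
      (measurable_snd.comp ((measurable_pi_apply i).comp measurable_fst))
  have hmono : ∀ (s : MultiIndex d (lfloor β)) i, Measurable
      fun p : (Fin n → Obs d) × Feature d => mono s (h⁻¹ • ((p.1 i).1 - p.2)) :=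
    fun s i => (continuous_mono s).measurable.comp (hX i)
  have hKi : ∀ i, Measurable
      fun p : (Fin n → Obs d) × Feature d => K (h⁻¹ • ((p.1 i).1 - p.2)) :=
    fun i => hK.comp (hX i)
  have hM : ∀ s t, Measurable fun p : (Fin n → Obs d) × Feature d =>
      designMatrix (lfloor β) K h p.1 p.2 s t := fun s t => by
    simp only [designMatrix_apply]
    exact (Finset.measurable_fun_sum _ fun i _ =>
      ((hmono s i).mul (hmono t i)).mul (hKi i)).const_mul _
  have hV : ∀ s, Measurable fun p : (Fin n → Obs d) × Feature d =>
      designVector (lfloor β) K h p.1 p.2 s := fun s =>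
    (Finset.measurable_fun_sum _ fun i _ => ((hY i).mul (hmono s i)).mul (hKi i)).const_mul _
  have heta : Measurable fun p : (Fin n → Obs d) × Feature d => etaStar β K h p.1 p.2 := by
    have key : ∀ E F : (Fin n → Obs d) × Feature d → ℝ, Measurable E → Measurable F →
        Measurable fun p => open Classical in
          if 1 < E p * Real.log n then max 0 (min 1 (F p)) else 0 := fun E F hE hF =>
      Measurable.ite (measurableSet_lt measurable_const (hE.mul_const _))
        (measurable_const.max (measurable_const.min hF)) measurable_const
    simp only [etaStar_eq hn hh]
    refine key _ _ (measurable_minEigenvalue (fun p => isHermitian_designMatrix p.1 p.2) hM) ?_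
    simp only [mulVec, dotProduct]
    exact Finset.measurable_fun_sum _ fun j _ => (measurable_inv_apply hM _ _).mul (hV j)
  unfold plugInClassifier plugInRule
  classical
  exact Measurable.ite (measurableSet_le measurable_const heta) measurable_const measurable_const

end Estimator

/-! ### Hoeffding's inequality for empirical means -/

section Hoeffding

variable {α : Type*} [MeasurableSpace α]

/-- The empirical mean of `g` over a sample. -/
def empMean {n : ℕ} (g : α → ℝ) (D : Fin n → α) : ℝ := (n : ℝ)⁻¹ * ∑ i, g (D i)

/-- A variable with values in $[-M,M]$ is, after centring, sub-Gaussian with variance proxy $M^2$;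
the sum of independent copies obeys the Chernoff bound. -/
theorem measureReal_empMean_sub_ge_le (P : Measure α) [IsProbabilityMeasure P] {g : α → ℝ}
    (hg : Measurable g) {M : ℝ} (hM : 0 < M) (hb : ∀ᵐ z ∂P, |g z| ≤ M) {ε : ℝ} (hε : 0 ≤ ε)
    {n : ℕ} (hn : 0 < n) :
    (Measure.pi fun _ : Fin n => P).real {D | ε ≤ empMean g D - ∫ z, g z ∂P} ≤
      Real.exp (-(ε ^ 2 / (2 * M ^ 2)) * n) := by
  have hn' : (0 : ℝ) < n := by exact_mod_cast hn
  have hsub : HasSubgaussianMGF (fun z => g z - ∫ z, g z ∂P) ((‖M - -M‖₊ / 2) ^ 2) P :=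
    hasSubgaussianMGF_of_mem_Icc hg.aemeasurable (hb.mono fun z hz => abs_le.1 hz)
  have hind : iIndepFun (fun (i : Fin n) (D : Fin n → α) => g (D i) - ∫ z, g z ∂P)
      (Measure.pi fun _ : Fin n => P) :=
    iIndepFun_pi (X := fun _ z => g z - ∫ z, g z ∂P) fun i => (hg.sub_const _).aemeasurable
  have hsub' : ∀ i ∈ (Finset.univ : Finset (Fin n)), HasSubgaussianMGF
      (fun D : Fin n → α => g (D i) - ∫ z, g z ∂P) ((‖M - -M‖₊ / 2) ^ 2)
      (Measure.pi fun _ : Fin n => P) := fun i _ => by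
    refine HasSubgaussianMGF.of_map (X := fun z => g z - ∫ z, g z ∂P)
      (Y := fun D : Fin n → α => D i) (measurable_pi_apply i).aemeasurable ?_
    rwa [(measurePreserving_eval (fun _ : Fin n => P) i).map_eq]
  have h := HasSubgaussianMGF.measure_sum_ge_le_of_iIndepFun hind hsub' (ε := n * ε)
    (by positivity)
  have hset : {D : Fin n → α | ε ≤ empMean g D - ∫ z, g z ∂P} =
      {D | n * ε ≤ ∑ i, (g (D i) - ∫ z, g z ∂P)} := by
    ext D
    simp only [Set.mem_ofPred_eq, empMean, Finset.sum_sub_distrib, Finset.sum_const,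
      Finset.card_univ, Fintype.card_fin, nsmul_eq_mul]
    rw [← mul_le_mul_iff_right₀ hn', mul_sub, mul_inv_cancel_left₀ hn'.ne']
  rw [hset]
  refine h.trans (le_of_eq ?_)
  congr 1
  have hc : (((‖M - -M‖₊ / 2) ^ 2 : NNReal) : ℝ) = M ^ 2 := by
    push_cast
    rw [Real.norm_eq_abs, sub_neg_eq_add, abs_of_pos (by positivity)]
    ring
  simp only [Finset.sum_const, Finset.card_univ, Fintype.card_fin, nsmul_eq_mul, NNReal.coe_mul,
    NNReal.coe_natCast, hc]
  field_simp

theorem measureReal_abs_empMean_sub_ge_le (P : Measure α) [IsProbabilityMeasure P] {g : α → ℝ}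
    (hg : Measurable g) {M : ℝ} (hM : 0 < M) (hb : ∀ᵐ z ∂P, |g z| ≤ M) {ε : ℝ} (hε : 0 ≤ ε)
    {n : ℕ} (hn : 0 < n) :
    (Measure.pi fun _ : Fin n => P).real {D | ε ≤ |empMean g D - ∫ z, g z ∂P|} ≤
      2 * Real.exp (-(ε ^ 2 / (2 * M ^ 2)) * n) := by
  have h1 := measureReal_empMean_sub_ge_le P hg hM hb hε hn
  have h2 := measureReal_empMean_sub_ge_le P hg.neg hM (hb.mono fun z hz => by simpa using hz) hε hn
  have hset : {D : Fin n → α | ε ≤ |empMean g D - ∫ z, g z ∂P|} ⊆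
      {D | ε ≤ empMean g D - ∫ z, g z ∂P} ∪
      {D | ε ≤ empMean (fun z => -g z) D - ∫ z, -g z ∂P} := by
    intro D hD
    rcases le_abs.1 (show ε ≤ |empMean g D - ∫ z, g z ∂P| from hD) with h | h
    · exact Or.inl h
    · refine Or.inr ?_
      simp only [Set.mem_ofPred_eq, empMean, Finset.sum_neg_distrib, integral_neg] at h ⊢
      linarith
  calc _ ≤ _ := measureReal_mono hset
    _ ≤ _ := measureReal_union_le _ _
    _ ≤ _ := by rw [two_mul]; exact add_le_add h1 h2

end Hoeffding

/-! ### Regression functions and excess risk -/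

section Risk

variable {d : ℕ} {P : Measure (Obs d)} {η : Feature d → ℝ}

/-- The label of an observation as a real number. -/
def label (z : Obs d) : ℝ := ((z.2 : ℕ) : ℝ)

theorem measurable_label : Measurable (label : Obs d → ℝ) :=
  (measurable_of_countable fun y : Fin 2 => ((y : ℕ) : ℝ)).comp measurable_snd

theorem label_mem (z : Obs d) : 0 ≤ label z ∧ label z ≤ 1 := by
  refine ⟨Nat.cast_nonneg _, ?_⟩
  have : (z.2 : ℕ) ≤ 1 := by lia
  rw [label]
  exact_mod_cast this

theorem label_eq_indicator : (label : Obs d → ℝ) = {z : Obs d | z.2 = 1}.indicator fun _ => 1 := by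
  ext ⟨x, y⟩
  fin_cases y <;> simp [label, Set.indicator]

theorem integrable_label [IsFiniteMeasure P] : Integrable (label : Obs d → ℝ) P :=
  Integrable.of_bound measurable_label.aestronglyMeasurable 1 (Filter.Eventually.of_forall fun z => by
    rw [Real.norm_eq_abs, abs_of_nonneg (label_mem z).1]
    exact (label_mem z).2)

theorem IsRegressionFunction.ae_mem_Icc [IsProbabilityMeasure P] (hη : IsRegressionFunction P η) :
    ∀ᵐ z ∂P, 0 ≤ η z.1 ∧ η z.1 ≤ 1 := by
  have h := hη.2
  rw [← label_eq_indicator] at h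
  have h0 : 0 ≤ᵐ[P] P[(label : Obs d → ℝ)|MeasurableSpace.comap Prod.fst inferInstance] :=
    condExp_nonneg (Filter.Eventually.of_forall fun z => (label_mem z).1)
  have h1 : P[(label : Obs d → ℝ)|MeasurableSpace.comap Prod.fst inferInstance] ≤ᵐ[P]
      P[(fun _ => (1 : ℝ))|MeasurableSpace.comap Prod.fst inferInstance] :=
    condExp_mono integrable_label (integrable_const _)
      (Filter.Eventually.of_forall fun z => (label_mem z).2)
  rw [condExp_const measurable_fst.comap_le] at h1
  filter_upwards [h, h0, h1] with z hz h0 h1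
  rw [hz] at h0 h1
  exact ⟨h0, h1⟩

theorem IsRegressionFunction.integral_mul_label [IsProbabilityMeasure P]
    (hη : IsRegressionFunction P η) {g : Feature d → ℝ} (hg : Measurable g) {M : ℝ}
    (hb : ∀ x, |g x| ≤ M) :
    ∫ z, g z.1 * label z ∂P = ∫ z, g z.1 * η z.1 ∂P := by
  have hm : MeasurableSpace.comap (Prod.fst : Obs d → Feature d) inferInstance ≤
      (inferInstance : MeasurableSpace (Obs d)) := measurable_fst.comap_le
  have h := hη.2
  rw [← label_eq_indicator] at h
  have hint : Integrable ((fun z : Obs d => g z.1) * label) P := by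
    refine Integrable.bdd_mul (c := M) integrable_label
      (hg.comp measurable_fst).aestronglyMeasurable (Filter.Eventually.of_forall fun z => hb _)
  have hsm : StronglyMeasurable[MeasurableSpace.comap (Prod.fst : Obs d → Feature d) inferInstance]
      (fun z : Obs d => g z.1) :=
    (hg.comp (comap_measurable (Prod.fst : Obs d → Feature d))).stronglyMeasurable
  have h2 := condExp_mul_of_stronglyMeasurable_left hsm hint integrable_label
  calc ∫ z, g z.1 * label z ∂P = ∫ z, ((fun z : Obs d => g z.1) * (label : Obs d → ℝ)) z ∂P := rfl
    _ = ∫ z, (P[(fun z : Obs d => g z.1) * (label : Obs d → ℝ)|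
          MeasurableSpace.comap Prod.fst inferInstance]) z ∂P := (integral_condExp hm).symm
    _ = ∫ z, g z.1 * η z.1 ∂P := integral_congr_ae (by
        filter_upwards [h2, h] with z hz hz'
        rw [hz, Pi.mul_apply, hz'])

theorem fin_two_cast_mem (y : Fin 2) : ((y : ℕ) : ℝ) = 0 ∨ ((y : ℕ) : ℝ) = 1 := by
  fin_cases y <;> simp

/-- For $f,y\in\{0,1\}$ one has $\mathbf 1\{y\ne f\}=f+(1-2f)y$, which is affine in $y$;
conditioning on $X$ replaces $y$ by $\eta$. -/
theorem risk_eq_integral [IsProbabilityMeasure P] (hη : IsRegressionFunction P η)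
    {f : Feature d → Fin 2} (hf : Measurable f) :
    risk P f = ∫ z, (((f z.1 : ℕ) : ℝ) + (1 - 2 * ((f z.1 : ℕ) : ℝ)) * η z.1) ∂P := by
  have hφ : Measurable fun x => ((f x : ℕ) : ℝ) :=
    (measurable_of_countable fun y : Fin 2 => ((y : ℕ) : ℝ)).comp hf
  have hφb : ∀ x, |((f x : ℕ) : ℝ)| ≤ 1 := fun x => by
    rcases fin_two_cast_mem (f x) with h | h <;> simp [h]
  have hgb : ∀ x, |1 - 2 * ((f x : ℕ) : ℝ)| ≤ 1 := fun x => by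
    rcases fin_two_cast_mem (f x) with h | h <;> norm_num [h]
  have hφi : Integrable (fun z : Obs d => ((f z.1 : ℕ) : ℝ)) P :=
    Integrable.of_bound (hφ.comp measurable_fst).aestronglyMeasurable 1
      (Filter.Eventually.of_forall fun z => hφb z.1)
  have hgm : Measurable fun x => 1 - 2 * ((f x : ℕ) : ℝ) := (hφ.const_mul 2).const_sub 1
  have hE : Integrable (fun z : Obs d => η z.1) P :=
    Integrable.of_bound (hη.1.comp measurable_fst).aestronglyMeasurable 1
      (hη.ae_mem_Icc.mono fun z hz => by rw [Real.norm_eq_abs, abs_of_nonneg hz.1]; exact hz.2)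
  have hset : MeasurableSet {z : Obs d | z.2 ≠ f z.1} :=
    (measurableSet_eq_fun measurable_snd (hf.comp measurable_fst)).compl
  have hgi : ∀ {w : Obs d → ℝ}, Integrable w P →
      Integrable (fun z : Obs d => (1 - 2 * ((f z.1 : ℕ) : ℝ)) * w z) P := fun hw =>
    hw.bdd_mul (hgm.comp measurable_fst).aestronglyMeasurable
      (Filter.Eventually.of_forall fun z => hgb z.1)
  rw [risk, ← integral_indicator_one hset, integral_add hφi (hgi hE),
    ← hη.integral_mul_label hgm hgb, ← integral_add hφi (hgi integrable_label)]
  refine integral_congr_ae (Filter.Eventually.of_forall fun z => ?_)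
  obtain ⟨x, y⟩ := z
  simp only [label, Set.indicator, Set.mem_ofPred_eq, Pi.one_apply]
  generalize f x = a
  fin_cases y <;> fin_cases a <;> norm_num

theorem measurable_plugInRule (hη : Measurable η) : Measurable (plugInRule η) := by
  classical
  exact Measurable.ite (measurableSet_le measurable_const hη) measurable_const measurable_const

/-- The weight $|2\eta-1|$ in the excess risk is bounded by $1$ and vanishes where $\eta=1/2$.
Nothing finer is needed for an exponential rate. -/
theorem risk_sub_risk_le [IsProbabilityMeasure P] (hη : IsRegressionFunction P η)
    {f : Feature d → Fin 2} (hf : Measurable f) :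
    risk P f - risk P (plugInRule η) ≤
      ∫ z, {z : Obs d | f z.1 ≠ plugInRule η z.1 ∧ η z.1 ≠ 1 / 2}.indicator (fun _ => (1 : ℝ)) z
        ∂P := by
  have hfs := measurable_plugInRule hη.1
  have hi : ∀ {g : Feature d → Fin 2}, Measurable g → Integrable (fun z : Obs d =>
      ((g z.1 : ℕ) : ℝ) + (1 - 2 * ((g z.1 : ℕ) : ℝ)) * η z.1) P := by
    intro g hg
    have hφ : Measurable fun x => ((g x : ℕ) : ℝ) :=
      (measurable_of_countable fun y : Fin 2 => ((y : ℕ) : ℝ)).comp hg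
    refine Integrable.of_bound (C := 2) (((hφ.add (((hφ.const_mul 2).const_sub 1).mul hη.1)).comp
      measurable_fst).aestronglyMeasurable) (hη.ae_mem_Icc.mono fun z hz => ?_)
    rw [Real.norm_eq_abs, abs_le]
    rcases fin_two_cast_mem (g z.1) with h | h <;> rw [h] <;> constructor <;> linarith [hz.1, hz.2]
  rw [risk_eq_integral hη hf, risk_eq_integral hη hfs, ← integral_sub (hi hf) (hi hfs)]
  have hset : MeasurableSet {z : Obs d | f z.1 ≠ plugInRule η z.1 ∧ η z.1 ≠ 1 / 2} :=
    (measurableSet_eq_fun (hf.comp measurable_fst) (hfs.comp measurable_fst)).compl.inter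
      (measurableSet_eq_fun (hη.1.comp measurable_fst) measurable_const).compl
  refine integral_mono_ae ((hi hf).sub (hi hfs)) ((integrable_const 1).indicator hset) ?_
  filter_upwards [hη.ae_mem_Icc] with z hz
  by_cases hz2 : f z.1 ≠ plugInRule η z.1 ∧ η z.1 ≠ 1 / 2
  · rw [Set.indicator_of_mem (by exact hz2)]
    rcases fin_two_cast_mem (f z.1) with h | h <;>
      rcases fin_two_cast_mem (plugInRule η z.1) with h' | h' <;> rw [h, h'] <;>
      linarith [hz.1, hz.2]
  · rw [Set.indicator_of_notMem (by exact hz2)]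
    rw [not_and_or, not_ne_iff, not_ne_iff] at hz2
    rcases hz2 with h | h
    · rw [h, sub_self]
    · rw [h]
      linarith

theorem excessRisk_le {n : ℕ} [IsProbabilityMeasure P] (hη : IsRegressionFunction P η)
    {f : (Fin n → Obs d) → Feature d → Fin 2}
    (hf : Measurable fun p : (Fin n → Obs d) × Feature d => f p.1 p.2) {B : ℝ}
    (hB : ∀ᵐ z ∂P, η z.1 ≠ 1 / 2 →
      (Measure.pi fun _ : Fin n => P).real {D | f D z.1 ≠ plugInRule η z.1} ≤ B) (hB0 : 0 ≤ B) :
    excessRisk P η f ≤ B := by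
  set Q := Measure.pi fun _ : Fin n => P with hQ
  have hfs := measurable_plugInRule hη.1
  have hfD : ∀ D, Measurable (f D) := fun D => hf.comp measurable_prodMk_left
  have hfz : Measurable fun p : (Fin n → Obs d) × Obs d => f p.1 p.2.1 :=
    hf.comp (measurable_fst.prodMk (measurable_fst.comp measurable_snd))
  have hset : MeasurableSet {p : (Fin n → Obs d) × Obs d |
      f p.1 p.2.1 ≠ plugInRule η p.2.1 ∧ η p.2.1 ≠ 1 / 2} :=
    (measurableSet_eq_fun hfz (hfs.comp (measurable_fst.comp measurable_snd))).compl.inter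
      (measurableSet_eq_fun (hη.1.comp (measurable_fst.comp measurable_snd)) measurable_const).compl
  have hrisk : Measurable fun D => risk P (f D) :=
    (measurable_measure_prodMk_left (ν := P) (s := {p : (Fin n → Obs d) × Obs d | p.2.2 ≠ f p.1 p.2.1})
      (measurableSet_eq_fun (measurable_snd.comp measurable_snd) hfz).compl).ennreal_toReal
  have hriski : Integrable (fun D => risk P (f D)) Q :=
    Integrable.of_bound hrisk.aestronglyMeasurable 1 (Filter.Eventually.of_forall fun D => by
      rw [risk, Real.norm_eq_abs, abs_of_nonneg measureReal_nonneg]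
      exact measureReal_le_one)
  set F : (Fin n → Obs d) → Obs d → ℝ := fun D z =>
    {z : Obs d | f D z.1 ≠ plugInRule η z.1 ∧ η z.1 ≠ 1 / 2}.indicator (fun _ => (1 : ℝ)) z with hF
  have hFi : Integrable (Function.uncurry F) (Q.prod P) := by
    have := (integrable_const (μ := Q.prod P) (1 : ℝ)).indicator hset
    exact this
  calc excessRisk P η f = ∫ D, (risk P (f D) - risk P (plugInRule η)) ∂Q := by
        rw [excessRisk, integral_sub hriski (integrable_const _)]
        simp [hQ]
    _ ≤ ∫ D, ∫ z, F D z ∂P ∂Q :=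
        integral_mono (hriski.sub (integrable_const _)) hFi.integral_prod_left
          fun D => risk_sub_risk_le hη (hfD D)
    _ = ∫ z, ∫ D, F D z ∂Q ∂P := integral_integral_swap hFi
    _ ≤ ∫ _z, B ∂P := by
        refine integral_mono_ae hFi.integral_prod_right (integrable_const _) ?_
        filter_upwards [hB] with z hz
        by_cases h : η z.1 = 1 / 2
        · simpa [hF, h] using hB0
        · have hs : MeasurableSet {D | f D z.1 ≠ plugInRule η z.1} :=
            (measurableSet_eq_fun (hf.comp measurable_prodMk_right) measurable_const).compl
          have h3 : (fun D => F D z) = {D | f D z.1 ≠ plugInRule η z.1}.indicator 1 := by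
            ext D
            simp only [hF, Set.indicator, Set.mem_ofPred_eq, ne_eq, h, not_false_eq_true, and_true,
              Pi.one_apply]
          rw [h3, integral_indicator_one hs]
          exact hz h
    _ = B := by simp

end Risk

/-! ### Accuracy of the estimator when the empirical moments are close to their means -/

section Accuracy

variable {d n l : ℕ} {K : Feature d → ℝ} {h : ℝ} {η : Feature d → ℝ}

theorem empMean_sum {α ι : Type*} [Fintype ι] (c : ι → ℝ) (g : ι → α → ℝ) (D : Fin n → α) :
    empMean (fun z => ∑ s, c s * g s z) D = ∑ s, c s * empMean (g s) D := by
  simp only [empMean, Finset.mul_sum]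
  rw [Finset.sum_comm]
  exact Finset.sum_congr rfl fun s _ => Finset.sum_congr rfl fun i _ => by ring

theorem polyVal_sub_single (v : MultiIndex d l → ℝ) (c : ℝ) (u : Feature d) :
    polyVal (v - Pi.single (zeroIndex d l) c) u = polyVal v u - c := by
  rw [polyVal_sub]
  simp [polyVal, Pi.single_apply, mono_zeroIndex]

/-- The basic inequality of least squares against the constant competitor $\eta(x)$. Write
$Y-\eta(x)=\xi+\Delta$ with noise $\xi=Y-\eta(X)$ and bias $\Delta=\eta(X)-\eta(x)$, and let $p$ be
the fit minus $\eta(x)$. Minimality gives $\sum p^2K\le2\sum p(\xi+\Delta)K$, and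
$2p\Delta\le\frac12p^2+2\Delta^2$ absorbs half of the left side. -/
theorem half_empMean_sq_le (hn : 0 < n) (hK : ∀ u, 0 ≤ K u) {D : Fin n → Obs d} {x : Feature d}
    {v : MultiIndex d l → ℝ} (hmin : IsLPMinimizer l K h D x (toPolyScaled h v))
    {w : MultiIndex d l → ℝ} (hw : w = v - Pi.single (zeroIndex d l) (η x)) :
    1 / 2 * empMean (fun z => polyVal w (h⁻¹ • (z.1 - x)) ^ 2 * K (h⁻¹ • (z.1 - x))) D ≤
      2 * ∑ s, w s * empMean (fun z => (label z - η z.1) *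
        (mono s (h⁻¹ • (z.1 - x)) * K (h⁻¹ • (z.1 - x)))) D +
      2 * empMean (fun z => (η z.1 - η x) ^ 2 * K (h⁻¹ • (z.1 - x))) D := by
  have h1 := hmin.2 (MvPolynomial.C (η x)) (by simp)
  simp only [lpCriterion, eval_toPolyScaled, MvPolynomial.eval_C] at h1
  rw [← empMean_sum]
  simp only [empMean]
  rw [mul_left_comm, mul_left_comm (2 : ℝ), mul_left_comm (2 : ℝ), ← mul_add]
  refine mul_le_mul_of_nonneg_left ?_ (by positivity)
  have h2 : ∀ z : Obs d, 1 / 2 * (polyVal w (h⁻¹ • (z.1 - x)) ^ 2 * K (h⁻¹ • (z.1 - x))) ≤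
      2 * (∑ s, w s * ((label z - η z.1) * (mono s (h⁻¹ • (z.1 - x)) * K (h⁻¹ • (z.1 - x))))) +
      2 * ((η z.1 - η x) ^ 2 * K (h⁻¹ • (z.1 - x))) +
      ((label z - polyVal v (h⁻¹ • (z.1 - x))) ^ 2 * K (h⁻¹ • (z.1 - x)) -
        (label z - η x) ^ 2 * K (h⁻¹ • (z.1 - x))) := by
    intro z
    have h3 : ∑ s, w s * ((label z - η z.1) *
        (mono s (h⁻¹ • (z.1 - x)) * K (h⁻¹ • (z.1 - x)))) =
        (label z - η z.1) * polyVal w (h⁻¹ • (z.1 - x)) * K (h⁻¹ • (z.1 - x)) := by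
      simp only [polyVal, Finset.mul_sum, Finset.sum_mul]
      exact Finset.sum_congr rfl fun s _ => by ring
    have h4 : polyVal v (h⁻¹ • (z.1 - x)) = polyVal w (h⁻¹ • (z.1 - x)) + η x := by
      rw [hw, polyVal_sub_single]
      ring
    rw [h3, h4]
    generalize polyVal w (h⁻¹ • (z.1 - x)) = p
    have hk := hK (h⁻¹ • (z.1 - x))
    have h5 := mul_nonneg hk (sq_nonneg (p - 2 * (η z.1 - η x)))
    nlinarith
  have h6 := Finset.sum_le_sum fun i (_ : i ∈ Finset.univ) => h2 (D i)
  rw [Finset.sum_add_distrib, Finset.sum_add_distrib, Finset.sum_sub_distrib, ← Finset.mul_sum,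
    ← Finset.mul_sum, ← Finset.mul_sum] at h6
  have h7 : (∑ i, (label (D i) - polyVal v (h⁻¹ • ((D i).1 - x))) ^ 2 * K (h⁻¹ • ((D i).1 - x)) -
      ∑ i, (label (D i) - η x) ^ 2 * K (h⁻¹ • ((D i).1 - x))) ≤ 0 := sub_nonpos.2 h1
  linarith

/-- If the design is nondegenerate, the noise is small and the regression function is nearly
constant in the weighted empirical sense, then a least squares fit is accurate at the centre. -/
theorem abs_eval_zero_sub_le (hn : 0 < n) (hh : 0 < h) (hK : ∀ u, 0 ≤ K u) {D : Fin n → Obs d}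
    {x : Feature d} {a τ b t : ℝ} (ha : 0 < a) (ht : 0 < t)
    (hA : ∀ v : MultiIndex d l → ℝ, a * ∑ s, v s ^ 2 ≤
      empMean (fun z => polyVal v (h⁻¹ • (z.1 - x)) ^ 2 * K (h⁻¹ • (z.1 - x))) D)
    (hN : ∀ s : MultiIndex d l, |empMean (fun z => (label z - η z.1) *
      (mono s (h⁻¹ • (z.1 - x)) * K (h⁻¹ • (z.1 - x)))) D| ≤ τ)
    (hB : empMean (fun z => (η z.1 - η x) ^ 2 * K (h⁻¹ • (z.1 - x))) D ≤ b)
    (hτ : 8 * (τ * (1 + Fintype.card (MultiIndex d l))) ≤ a * t) (hb : 16 * b ≤ a * t ^ 2)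
    {θ : MvPolynomial (Fin d) ℝ} (hmin : IsLPMinimizer l K h D x θ) :
    |MvPolynomial.eval (fun _ => 0) θ - η x| ≤ t := by
  obtain ⟨v, rfl⟩ := exists_toPolyScaled_eq hh.ne' hmin.1
  set w := v - Pi.single (zeroIndex d l) (η x) with hw
  have h0 : MvPolynomial.eval (fun _ => 0) (toPolyScaled h v) - η x = w (zeroIndex d l) := by
    have h1 := eval_toPolyScaled h v (0 : Feature d)
    rw [smul_zero, polyVal_zero] at h1
    have h2 : MvPolynomial.eval (fun _ => 0) (toPolyScaled h v) = v (zeroIndex d l) := h1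
    rw [h2]
    simp [hw]
  rw [h0]
  by_contra hcon
  rw [not_le] at hcon
  have hτ0 : 0 ≤ τ := (abs_nonneg _).trans (hN (zeroIndex d l))
  have hmain := half_empMean_sq_le (η := η) hn hK hmin hw
  have hA' := hA w
  set S := ∑ s, w s ^ 2 with hS
  -- If the error at the centre exceeds `t`, then `t ^ 2 < S`. Noise and bias are then each at most
  -- `a * S / 8`, which contradicts the lower bound `a * S / 2`.
  have hSt : t ^ 2 < S := by
    have h1 : w (zeroIndex d l) ^ 2 ≤ S :=
      Finset.single_le_sum (f := fun s => w s ^ 2) (fun _ _ => sq_nonneg _) (Finset.mem_univ _)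
    have h2 : t ^ 2 < w (zeroIndex d l) ^ 2 := by
      rw [← sq_abs (w _)]
      gcongr
    linarith
  have hnoise : ∑ s, w s * empMean (fun z => (label z - η z.1) *
      (mono s (h⁻¹ • (z.1 - x)) * K (h⁻¹ • (z.1 - x)))) D ≤ ∑ s, |w s| * τ := by
    refine Finset.sum_le_sum fun s _ => (le_abs_self _).trans ?_
    rw [abs_mul]
    exact mul_le_mul_of_nonneg_left (hN s) (abs_nonneg _)
  -- Using $2t|w_s|\le w_s^2+t^2$ and $t^2<S$ bounds the $\ell^1$ norm linearly in `S`, so that it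
  -- can be absorbed.
  have habs : 2 * t * ∑ s, |w s| ≤ (1 + Fintype.card (MultiIndex d l)) * S := by
    have h1 : ∀ s, 2 * t * |w s| ≤ w s ^ 2 + t ^ 2 := fun s => by
      nlinarith [sq_nonneg (|w s| - t), sq_abs (w s)]
    have h2 : 2 * t * ∑ s, |w s| ≤ S + Fintype.card (MultiIndex d l) * t ^ 2 := by
      rw [Finset.mul_sum]
      refine (Finset.sum_le_sum fun s _ => h1 s).trans (le_of_eq ?_)
      simp [Finset.sum_add_distrib, hS]
    have h3 : (0 : ℝ) ≤ Fintype.card (MultiIndex d l) := Nat.cast_nonneg _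
    nlinarith
  rw [← Finset.sum_mul] at hnoise
  have h1 : 1 / 2 * (a * S) ≤ 2 * ((∑ s, |w s|) * τ) + 2 * b := by linarith
  have hSpos : 0 < S := (sq_nonneg t).trans_lt hSt
  have h2 : 8 * t * ((∑ s, |w s|) * τ) * 2 ≤ a * t * S := by
    have := mul_le_mul_of_nonneg_right hτ hSpos.le
    have h4 := mul_le_mul_of_nonneg_right habs hτ0
    nlinarith
  have h3 : 16 * ((∑ s, |w s|) * τ) ≤ a * S := by
    have : t * (16 * ((∑ s, |w s|) * τ)) ≤ t * (a * S) := by linarith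
    exact le_of_mul_le_mul_left this ht
  have h5 : a * t ^ 2 < a * S := mul_lt_mul_of_pos_left hSt ha
  have h6 : 0 < a * S := mul_pos ha hSpos
  linarith

theorem plugInRule_clip_eq {y e t : ℝ} (ht : 0 ≤ t) (hy : t < |y - 1 / 2|) (he : |e - y| ≤ t) :
    (1 / 2 ≤ max 0 (min 1 e)) ↔ 1 / 2 ≤ y := by
  rw [le_max_iff, le_min_iff]
  rw [abs_le] at he
  rcases lt_abs.1 hy with h | h
  · exact iff_of_true (Or.inr ⟨by norm_num, by linarith⟩) (by linarith)
  · refine iff_of_false ?_ (by linarith)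
    rintro (h' | h')
    · norm_num at h'
    · linarith [h'.2]

theorem plugInClassifier_eq_plugInRule {β : ℝ} (hn : 0 < n) (hh : 0 < h) (hK : ∀ u, 0 ≤ K u)
    {D : Fin n → Obs d} {x : Feature d} {a τ b t : ℝ} (ha : 0 < a) (ht : 0 < t)
    (hA : ∀ v : MultiIndex d (lfloor β) → ℝ, a * ∑ s, v s ^ 2 ≤
      empMean (fun z => polyVal v (h⁻¹ • (z.1 - x)) ^ 2 * K (h⁻¹ • (z.1 - x))) D)
    (hN : ∀ s : MultiIndex d (lfloor β), |empMean (fun z => (label z - η z.1) *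
      (mono s (h⁻¹ • (z.1 - x)) * K (h⁻¹ • (z.1 - x)))) D| ≤ τ)
    (hB : empMean (fun z => (η z.1 - η x) ^ 2 * K (h⁻¹ • (z.1 - x))) D ≤ b)
    (hτ : 8 * (τ * (1 + Fintype.card (MultiIndex d (lfloor β)))) ≤ a * t)
    (hb : 16 * b ≤ a * t ^ 2) (hη : t < |η x - 1 / 2|) (hlog : 1 < a / h ^ d * Real.log n) :
    plugInClassifier β K h D x = plugInRule η x := by
  have hhd : 0 < h ^ d := by positivity
  -- The design matrix is normalized by $nh^d$ and the empirical mean by $n$ only; this is the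
  -- source of the factor $h^{-d}$.
  have heig : a / h ^ d ≤ minEigenvalue (designMatrix (lfloor β) K h D x) := by
    rw [le_minEigenvalue_iff (isHermitian_designMatrix D x)]
    intro v
    rw [dotProduct_designMatrix_mulVec, mul_inv, mul_comm (n : ℝ)⁻¹, mul_assoc, div_mul_eq_mul_div,
      div_eq_inv_mul]
    exact mul_le_mul_of_nonneg_left (hA v) (by positivity)
  have hpos : 0 < minEigenvalue (designMatrix (lfloor β) K h D x) :=
    (by positivity : 0 < a / h ^ d).trans_le heig
  obtain ⟨H, -⟩ := existsUnique_isLPMinimizer hn hh D x hpos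
  have hcond : 1 < minEigenvalue (designMatrix (lfloor β) K h D x) * Real.log n :=
    hlog.trans_le (mul_le_mul_of_nonneg_right heig (Real.log_natCast_nonneg n))
  have hest : |lpEstimator (lfloor β) K h D x - η x| ≤ t := by
    rw [lpEstimator, dif_pos H]
    exact abs_eval_zero_sub_le hn hh hK ha ht hA hN hB hτ hb H.choose_spec.1
  simp only [plugInClassifier, plugInRule, etaStar, if_pos hcond]
  simp only [plugInRule_clip_eq ht.le hη hest]

end Accuracy

/-! ### The probability of misclassification at a point -/

section Concentration

variable {d n l : ℕ} {K : Feature d → ℝ} {h : ℝ} {η : Feature d → ℝ}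

theorem measureReal_exists_abs_empMean_sub_ge_le {α J : Type*} [MeasurableSpace α] [Fintype J]
    (P : Measure α) [IsProbabilityMeasure P] {g : J → α → ℝ}
    (hg : ∀ j, Measurable (g j)) {M : ℝ} (hM : 0 < M) (hb : ∀ j, ∀ᵐ z ∂P, |g j z| ≤ M) {ε : ℝ}
    (hε : 0 ≤ ε) (hn : 0 < n) :
    (Measure.pi fun _ : Fin n => P).real {D | ∃ j, ε ≤ |empMean (g j) D - ∫ z, g j z ∂P|} ≤
      2 * Fintype.card J * Real.exp (-(ε ^ 2 / (2 * M ^ 2)) * n) := by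
  rw [Set.ofPred_exists]
  refine (measureReal_iUnion_fintype_le _).trans ((Finset.sum_le_sum fun j _ =>
    measureReal_abs_empMean_sub_ge_le P (hg j) hM (hb j) hε hn).trans (le_of_eq ?_))
  simp
  ring

/-- The functions of an observation whose empirical means govern the estimator at `x`. -/
def moments (l : ℕ) (K : Feature d → ℝ) (h : ℝ) (η : Feature d → ℝ) (x : Feature d) :
    (MultiIndex d l × MultiIndex d l) ⊕ (MultiIndex d l ⊕ Unit) → Obs d → ℝ
  | Sum.inl (s, t), z =>
      mono s (h⁻¹ • (z.1 - x)) * mono t (h⁻¹ • (z.1 - x)) * K (h⁻¹ • (z.1 - x))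
  | Sum.inr (Sum.inl s), z =>
      (label z - η z.1) * (mono s (h⁻¹ • (z.1 - x)) * K (h⁻¹ • (z.1 - x)))
  | Sum.inr (Sum.inr _), z => (η z.1 - η x) ^ 2 * K (h⁻¹ • (z.1 - x))

theorem measurable_moments (hK : Measurable K) (hη : Measurable η) (x : Feature d) (j) :
    Measurable (moments l K h η x j) := by
  have hU : Measurable fun z : Obs d => h⁻¹ • (z.1 - x) := by fun_prop
  have hKU : Measurable fun z : Obs d => K (h⁻¹ • (z.1 - x)) := hK.comp hU
  have hmU : ∀ s : MultiIndex d l, Measurable fun z : Obs d => mono s (h⁻¹ • (z.1 - x)) :=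
    fun s => (continuous_mono s).measurable.comp hU
  have hηz : Measurable fun z : Obs d => η z.1 := hη.comp measurable_fst
  rcases j with ⟨s, t⟩ | s | _
  · exact ((hmU s).mul (hmU t)).mul hKU
  · exact (measurable_label.sub hηz).mul ((hmU s).mul hKU)
  · exact ((hηz.sub_const _).pow_const 2).mul hKU

/-- One constant serves all moments: taking one or both indices equal to `zeroIndex` makes `M` bound
$|u^sK(u)|$ and $K(u)$ as well, while the factors in $Y$ and $\eta$ are at most $1$ in modulus. -/
theorem ae_abs_moments_le {P : Measure (Obs d)} {M : ℝ}
    (hM : ∀ (s t : MultiIndex d l) u, |mono s u * mono t u * K u| ≤ M)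
    (hη : ∀ᵐ z ∂P, 0 ≤ η z.1 ∧ η z.1 ≤ 1) {x : Feature d} (hx : 0 ≤ η x ∧ η x ≤ 1) (j) :
    ∀ᵐ z ∂P, |moments l K h η x j z| ≤ M := by
  filter_upwards [hη] with z hz
  have hzero : ∀ (s : MultiIndex d l) u, |mono s u * K u| ≤ M := fun s u => by
    simpa [mono_zeroIndex] using hM s (zeroIndex d l) u
  have hM0 : 0 ≤ M := (abs_nonneg _).trans (hzero (zeroIndex d l) 0)
  rcases j with ⟨s, t⟩ | s | _
  · exact hM s t _
  · simp only [moments]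
    rw [abs_mul]
    have h1 : |label z - η z.1| ≤ 1 := by
      have := label_mem z
      rw [abs_le]
      constructor <;> linarith
    calc _ ≤ 1 * M := mul_le_mul h1 (hzero s _) (abs_nonneg _) zero_le_one
      _ = M := one_mul M
  · simp only [moments]
    rw [abs_mul, abs_of_nonneg (sq_nonneg _)]
    have h1 : (η z.1 - η x) ^ 2 ≤ 1 := by
      rw [sq_le_one_iff_abs_le_one, abs_le]
      constructor <;> linarith
    have h2 : |K (h⁻¹ • (z.1 - x))| ≤ M := by
      simpa [mono_zeroIndex] using hzero (zeroIndex d l) (h⁻¹ • (z.1 - x))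
    calc _ ≤ 1 * M := mul_le_mul h1 h2 (abs_nonneg _) zero_le_one
      _ = M := one_mul M

theorem measureReal_plugInClassifier_ne_le {β : ℝ} {P : Measure (Obs d)} [IsProbabilityMeasure P]
    (hreg : IsRegressionFunction P η) (hn : 0 < n) (hh : 0 < h) (hKm : Measurable K)
    (hK : ∀ u, 0 ≤ K u) {M : ℝ} (hMpos : 0 < M)
    (hM : ∀ (s t : MultiIndex d (lfloor β)) u, |mono s u * mono t u * K u| ≤ M)
    {x : Feature d} (hx : 0 ≤ η x ∧ η x ≤ 1) {a b t ε : ℝ} (ha : 0 < a) (ht : 0 < t) (hε : 0 < ε)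
    (hA : ∀ v : MultiIndex d (lfloor β) → ℝ, 2 * a * ∑ s, v s ^ 2 ≤
      ∫ z, polyVal v (h⁻¹ • (z.1 - x)) ^ 2 * K (h⁻¹ • (z.1 - x)) ∂P)
    (hB : ∫ z, (η z.1 - η x) ^ 2 * K (h⁻¹ • (z.1 - x)) ∂P ≤ b)
    (hεa : ε * Fintype.card (MultiIndex d (lfloor β)) ≤ a)
    (hετ : 8 * (ε * (1 + Fintype.card (MultiIndex d (lfloor β)))) ≤ a * t)
    (hεb : 16 * (b + ε) ≤ a * t ^ 2) (hη : t < |η x - 1 / 2|)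
    (hlog : 1 < a / h ^ d * Real.log n) :
    (Measure.pi fun _ : Fin n => P).real {D | plugInClassifier β K h D x ≠ plugInRule η x} ≤
      2 * Fintype.card ((MultiIndex d (lfloor β) × MultiIndex d (lfloor β)) ⊕
        (MultiIndex d (lfloor β) ⊕ Unit)) * Real.exp (-(ε ^ 2 / (2 * M ^ 2)) * n) := by
  refine le_trans (measureReal_mono ?_) (measureReal_exists_abs_empMean_sub_ge_le P
    (fun j => measurable_moments (l := lfloor β) (h := h) hKm hreg.1 x j) hMpos
    (fun j => ae_abs_moments_le hM hreg.ae_mem_Icc hx j) hε.le hn)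
  intro D hD
  by_contra hcon
  simp only [Set.mem_ofPred_eq, not_exists, not_le] at hcon
  refine hD (plugInClassifier_eq_plugInRule (τ := ε) (b := b + ε) hn hh hK ha ht ?_ ?_ ?_ hετ hεb
    hη hlog)
  · intro v
    have hE : empMean (fun z => polyVal v (h⁻¹ • (z.1 - x)) ^ 2 * K (h⁻¹ • (z.1 - x))) D =
        ∑ p : MultiIndex d (lfloor β) × MultiIndex d (lfloor β),
          v p.1 * v p.2 * empMean (moments (lfloor β) K h η x (Sum.inl p)) D := by
      rw [← empMean_sum]
      congr 1
      ext z
      rw [sq_polyVal, Fintype.sum_prod_type]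
      simp only [Finset.sum_mul, moments, mul_assoc]
    have hI : ∫ z, polyVal v (h⁻¹ • (z.1 - x)) ^ 2 * K (h⁻¹ • (z.1 - x)) ∂P =
        ∑ p : MultiIndex d (lfloor β) × MultiIndex d (lfloor β),
          v p.1 * v p.2 * ∫ z, moments (lfloor β) K h η x (Sum.inl p) z ∂P := by
      simp only [← integral_const_mul]
      rw [← integral_finsetSum]
      · congr 1
        ext z
        rw [sq_polyVal, Fintype.sum_prod_type]
        simp only [Finset.sum_mul, moments, mul_assoc]
      · intro p _
        exact (Integrable.of_bound (measurable_moments hKm hreg.1 x _).aestronglyMeasurable M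
          (ae_abs_moments_le hM hreg.ae_mem_Icc hx _)).const_mul _
    -- Entrywise deviations below `ε` move the quadratic form by at most
    -- $\varepsilon(\sum_s|v_s|)^2\le\varepsilon N\sum_sv_s^2$, where $N$ is the number of
    -- multi-indices. This uses up half of the constant `2 * a` in `hA`.
    have hdiff : |empMean (fun z => polyVal v (h⁻¹ • (z.1 - x)) ^ 2 * K (h⁻¹ • (z.1 - x))) D -
        ∫ z, polyVal v (h⁻¹ • (z.1 - x)) ^ 2 * K (h⁻¹ • (z.1 - x)) ∂P| ≤ a * ∑ s, v s ^ 2 := by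
      rw [hE, hI, ← Finset.sum_sub_distrib]
      calc _ ≤ ∑ p : MultiIndex d (lfloor β) × MultiIndex d (lfloor β), |v p.1| * |v p.2| * ε := by
            refine (Finset.abs_sum_le_sum_abs _ _).trans (Finset.sum_le_sum fun p _ => ?_)
            rw [← mul_sub, abs_mul, abs_mul]
            exact mul_le_mul_of_nonneg_left (hcon (Sum.inl p)).le (by positivity)
        _ = (∑ s, |v s|) ^ 2 * ε := by
            rw [← Finset.sum_mul, Fintype.sum_prod_type, sq, Finset.sum_mul_sum]
        _ ≤ (Fintype.card (MultiIndex d (lfloor β)) * ∑ s, v s ^ 2) * ε := by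
            gcongr
            have := sq_sum_le_card_mul_sum_sq (s := Finset.univ) (f := fun s => |v s|)
            simpa using this
        _ ≤ a * ∑ s, v s ^ 2 := by
            have : 0 ≤ ∑ s, v s ^ 2 := Finset.sum_nonneg fun s _ => sq_nonneg _
            nlinarith
    have h1 := hA v
    have h2 := (abs_le.1 hdiff).1
    linarith
  · intro s
    -- The noise moments are centred because $\eta$ is the regression function and the weights
    -- depend on $X$ only.
    have hzero : ∫ z, moments (lfloor β) K h η x (Sum.inr (Sum.inl s)) z ∂P = 0 := by
      have hU : Measurable fun y : Feature d => h⁻¹ • (y - x) := by fun_prop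
      have hg : Measurable fun y : Feature d => mono s (h⁻¹ • (y - x)) * K (h⁻¹ • (y - x)) :=
        ((continuous_mono s).measurable.comp hU).mul (hKm.comp hU)
      have hgb : ∀ y : Feature d, |mono s (h⁻¹ • (y - x)) * K (h⁻¹ • (y - x))| ≤ M := fun y => by
        simpa [mono_zeroIndex] using hM s (zeroIndex d (lfloor β)) (h⁻¹ • (y - x))
      have hgi : ∀ {w : Obs d → ℝ}, Integrable w P → Integrable (fun z : Obs d =>
          (mono s (h⁻¹ • (z.1 - x)) * K (h⁻¹ • (z.1 - x))) * w z) P := fun hw =>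
        hw.bdd_mul (hg.comp measurable_fst).aestronglyMeasurable
          (Filter.Eventually.of_forall fun z => hgb z.1)
      have hE : Integrable (fun z : Obs d => η z.1) P :=
        Integrable.of_bound (hreg.1.comp measurable_fst).aestronglyMeasurable 1
          (hreg.ae_mem_Icc.mono fun z hz => by
            rw [Real.norm_eq_abs, abs_of_nonneg hz.1]; exact hz.2)
      have h1 := hreg.integral_mul_label hg hgb
      rw [← sub_eq_zero, ← integral_sub (hgi integrable_label) (hgi hE)] at h1
      rw [← h1]
      congr 1
      ext z
      simp only [moments]
      ring
    have := hcon (Sum.inr (Sum.inl s))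
    rw [hzero, sub_zero] at this
    exact this.le
  · have h1 := (abs_lt.1 (hcon (Sum.inr (Sum.inr ())))).2
    have h2 : empMean (moments (lfloor β) K h η x (Sum.inr (Sum.inr ()))) D -
        ∫ z, (η z.1 - η x) ^ 2 * K (h⁻¹ • (z.1 - x)) ∂P < ε := h1
    have h3 : empMean (moments (lfloor β) K h η x (Sum.inr (Sum.inr ()))) D ≤ b + ε := by linarith
    exact h3

end Concentration

/-! ### Modulus of continuity of the regression function -/

section Modulus

variable {d l : ℕ}

/-- Expanding each argument in the standard basis exhibits the diagonal of a `k`-linear form as a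
polynomial of degree at most `k`. This makes Taylor polynomials accessible to the coefficient
bounds. -/
theorem exists_polyVal_eq_multilinear {k : ℕ} (hk : k ≤ l)
    (f : ContinuousMultilinearMap ℝ (fun _ : Fin k => Feature d) ℝ) :
    ∃ v : MultiIndex d l → ℝ, ∀ u : Feature d, f (fun _ => u) = polyVal v u := by
  set e := EuclideanSpace.basisFun (Fin d) ℝ with he
  set q : MvPolynomial (Fin d) ℝ := ∑ r : Fin k → Fin d,
    MvPolynomial.C (f fun i => e (r i)) * ∏ i, MvPolynomial.X (r i) with hq
  have hdeg : q.totalDegree ≤ l := by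
    refine MvPolynomial.totalDegree_finsetSum_le fun r _ => ?_
    refine (MvPolynomial.totalDegree_mul _ _).trans ?_
    rw [MvPolynomial.totalDegree_C, zero_add]
    refine (MvPolynomial.totalDegree_finsetProd _ _).trans ?_
    simpa using hk
  obtain ⟨v, hv⟩ := exists_toPoly_eq hdeg
  refine ⟨v, fun u => ?_⟩
  rw [← eval_toPoly, hv, hq]
  simp only [map_sum, map_mul, MvPolynomial.eval_C, map_prod, MvPolynomial.eval_X]
  have hu : u = ∑ j, u j • e j := by
    conv_lhs => rw [← e.sum_repr u]
    rfl
  calc f (fun _ => u) = f (fun _ => ∑ j, u j • e j) := by rw [← hu]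
    _ = ∑ r : Fin k → Fin d, f fun i => u (r i) • e (r i) :=
        f.toMultilinearMap.map_sum fun _ j => u j • e j
    _ = _ := by
        refine Finset.sum_congr rfl fun r _ => ?_
        rw [f.map_smul_univ (fun i => u (r i)) fun i => e (r i), smul_eq_mul, mul_comm]

theorem exists_polyVal_eq_taylorAt (l : ℕ) (g : Feature d → ℝ) (x : Feature d) :
    ∃ v : MultiIndex d l → ℝ, ∀ u : Feature d, taylorAt l g x (x + u) = polyVal v u := by
  have h : ∀ k : ℕ, ∃ v : MultiIndex d l → ℝ, k ≤ l → ∀ u : Feature d,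
      iteratedFDeriv ℝ k g x (fun _ => u) = polyVal v u := fun k => by
    by_cases hk : k ≤ l
    · obtain ⟨v, hv⟩ := exists_polyVal_eq_multilinear hk (iteratedFDeriv ℝ k g x)
      exact ⟨v, fun _ => hv⟩
    · exact ⟨0, fun h => absurd h hk⟩
  choose v hv using h
  refine ⟨∑ k ∈ Finset.range (l + 1), ((k.factorial : ℝ)⁻¹) • v k, fun u => ?_⟩
  simp only [taylorAt, add_sub_cancel_left, polyVal, Finset.sum_apply, Finset.sum_mul]
  rw [Finset.sum_comm]
  refine Finset.sum_congr rfl fun k hk => ?_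
  rw [hv k (Nat.lt_succ_iff.1 (Finset.mem_range.1 hk)) u, polyVal, Finset.mul_sum]
  exact Finset.sum_congr rfl fun s _ => by simp [mul_assoc]

theorem abs_polyVal_sub_zero_le {v : MultiIndex d l → ℝ} {B : ℝ} (hB : ∀ s, |v s| ≤ B)
    {u : Feature d} (hu : ‖u‖ ≤ 1) :
    |polyVal v u - polyVal v 0| ≤ Fintype.card (MultiIndex d l) * B * ‖u‖ := by
  have hm : ∀ s : MultiIndex d l, |mono s u - mono s 0| ≤ ‖u‖ := fun s => by
    by_cases hs : s = zeroIndex d l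
    · rw [hs, mono_zeroIndex, mono_zeroIndex, sub_self, abs_zero]
      exact norm_nonneg u
    · rw [mono_zero, if_neg hs, sub_zero]
      have hk : 1 ≤ ∑ j, (s.1 j : ℕ) := by
        by_contra hc
        have h0 : ∑ j, (s.1 j : ℕ) = 0 := by lia
        rw [Finset.sum_eq_zero_iff] at h0
        exact hs (Subtype.ext (funext fun j => Fin.ext (h0 j (Finset.mem_univ j))))
      calc |mono s u| ≤ ‖u‖ ^ (∑ j, (s.1 j : ℕ)) := abs_mono_le s u
        _ ≤ ‖u‖ ^ 1 := pow_le_pow_of_le_one (norm_nonneg u) hu hk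
        _ = ‖u‖ := pow_one _
  calc |polyVal v u - polyVal v 0| = |∑ s, v s * (mono s u - mono s 0)| := by
        simp only [polyVal, mul_sub, Finset.sum_sub_distrib]
    _ ≤ ∑ s, |v s * (mono s u - mono s 0)| := Finset.abs_sum_le_sum_abs _ _
    _ ≤ ∑ _s : MultiIndex d l, B * ‖u‖ := by
        refine Finset.sum_le_sum fun s _ => ?_
        rw [abs_mul]
        exact mul_le_mul (hB s) (hm s) (abs_nonneg _) ((abs_nonneg _).trans (hB s))
    _ = _ := by simp [mul_assoc]

theorem volume_inter_closedBall {T : Set (Feature d)} {x : Feature d} {h R : ℝ} (hh : 0 < h) :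
    volume {u : Feature d | u ∈ Metric.closedBall 0 R ∧ x + h • u ∈ T} =
      ENNReal.ofReal |(h ^ d)⁻¹| * volume (T ∩ Metric.closedBall x (h * R)) := by
  have h1 : {u : Feature d | u ∈ Metric.closedBall 0 R ∧ x + h • u ∈ T} =
      (fun u => h • u) ⁻¹' ((fun y => x + y) ⁻¹' (T ∩ Metric.closedBall x (h * R))) := by
    ext u
    simp only [Set.mem_ofPred_eq, Set.mem_preimage, Set.mem_inter_iff, Metric.mem_closedBall,
      dist_eq_norm, sub_zero, add_sub_cancel_left, norm_smul, Real.norm_eq_abs,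
      abs_of_pos hh, mul_le_mul_iff_right₀ hh]
    exact and_comm
  rw [h1, Measure.addHaar_preimage_smul volume hh.ne', measure_preimage_add]
  simp

theorem IsRegularSet.le_volume {c₀ r₀ h R : ℝ} {A : Set (Feature d)} (hA : IsRegularSet c₀ r₀ A)
    {x : Feature d} (hx : x ∈ A) (hh : 0 < h) (hR : 0 < R) (hr : h * R ≤ r₀) :
    ENNReal.ofReal c₀ * volume (Metric.closedBall (0 : Feature d) R) ≤
      volume {u : Feature d | u ∈ Metric.closedBall 0 R ∧ x + h • u ∈ A} := by
  have h1 := volume_inter_closedBall (T := Set.univ) (x := x) (R := R) hh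
  simp only [Set.mem_univ, and_true, Set.univ_inter, Set.ofPred_mem_eq] at h1
  rw [volume_inter_closedBall hh, h1, mul_left_comm]
  gcongr
  exact hA.2 _ (mul_pos hh hR) hr x hx

/-- A Hölder function with values in `[0, 1]` on a regular set has there a modulus of continuity
which depends only on the parameters of the two classes. -/
theorem exists_modulus (d : ℕ) {β L c₀ r₀ : ℝ} (hβ : 0 < β) (hL : 0 < L) (hc₀ : 0 < c₀)
    (hr₀ : 0 < r₀) :
    ∃ C : ℝ, 0 < C ∧ ∀ (η : Feature d → ℝ) (A : Set (Feature d)), HolderClass β L η →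
      MeasurableSet A → IsRegularSet c₀ r₀ A → (∀ᵐ y, y ∈ A → 0 ≤ η y ∧ η y ≤ 1) →
      ∀ x ∈ A, 0 ≤ η x ∧ η x ≤ 1 → ∀ y, 0 ≤ η y ∧ η y ≤ 1 →
        |η y - η x| ≤ min 1 (C * ‖y - x‖ + L * ‖y - x‖ ^ β) := by
  -- Radius at most `r₀` makes regularity available; radius at most `1` makes the Hölder remainder
  -- at most `L`.
  set ρ := min r₀ 1 with hρ
  have hρ0 : 0 < ρ := lt_min hr₀ one_pos
  obtain ⟨κ, hκ, H⟩ := exists_sq_sum_le_setIntegral d (lfloor β) hρ0 hc₀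
  set V := volume.real (Metric.closedBall (0 : Feature d) ρ) with hV
  set B := 1 + (1 + L) ^ 2 * V / κ with hB
  have hV0 : 0 ≤ V := measureReal_nonneg
  have hB1 : 1 ≤ B := by
    have : 0 ≤ (1 + L) ^ 2 * V / κ := by positivity
    linarith
  set N : ℝ := (Fintype.card (MultiIndex d (lfloor β)) : ℝ) with hN
  have hN0 : 0 ≤ N := Nat.cast_nonneg _
  -- The extra `1` settles points with `1 < ‖y - x‖`, where the oscillation of at most `1` is below
  -- `‖y - x‖`.
  refine ⟨N * B + 1, by positivity, ?_⟩
  intro η A hη hAm hA hae x hx hηx y hηy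
  obtain ⟨v, hv⟩ := exists_polyVal_eq_taylorAt (lfloor β) η x
  have hzero : η x = polyVal v 0 := by
    have h1 := hη.2 x x
    rw [sub_self, norm_zero, Real.zero_rpow hβ.ne', mul_zero, abs_nonpos_iff, sub_eq_zero] at h1
    rw [h1, ← hv 0, add_zero]
  have hhold : ∀ u : Feature d, |η (x + u) - polyVal v u| ≤ L * ‖u‖ ^ β := fun u => by
    have h1 := hη.2 x (x + u)
    rwa [hv u, sub_add_cancel_left, norm_neg] at h1
  -- On the part of `A` near `x` the Taylor polynomial is almost everywhere at most `1 + L` in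
  -- modulus. The thick-set inequality turns this `L²` bound into a bound on each coefficient, and
  -- $|v_s|\le1+v_s^2$ gives `B`.
  have hvB : ∀ s, |v s| ≤ B := by
    set S : Set (Feature d) := {u | u ∈ Metric.closedBall 0 ρ ∧ x + (1 : ℝ) • u ∈ A} with hS
    have hSm : MeasurableSet S := Metric.isClosed_closedBall.measurableSet.inter
      ((by fun_prop : Measurable fun u : Feature d => x + (1 : ℝ) • u) hAm)
    have h1 := H v S hSm (fun u hu => hu.1)
      (hA.le_volume hx one_pos hρ0 (by rw [one_mul]; exact min_le_left _ _))
    have hSV : volume.real S ≤ V := measureReal_mono (fun u hu => hu.1)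
      (measure_closedBall_lt_top (x := (0 : Feature d)) (r := ρ)).ne
    have h2 : ∫ u in S, polyVal v u ^ 2 ≤ (1 + L) ^ 2 * V := by
      have haeS : ∀ᵐ u : Feature d, x + u ∈ A → 0 ≤ η (x + u) ∧ η (x + u) ≤ 1 :=
        (measurePreserving_add_left volume x).quasiMeasurePreserving.ae hae
      calc ∫ u in S, polyVal v u ^ 2 ≤ ∫ _u in S, (1 + L) ^ 2 := by
            refine integral_mono_ae ?_ ?_ ?_
            · exact (((continuous_polyVal v).pow 2).continuousOn.integrableOn_compact
                (isCompact_closedBall (0 : Feature d) ρ)).mono_set fun u hu => hu.1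
            · exact integrableOn_const ((measure_mono (fun u hu => hu.1)).trans_lt
                (measure_closedBall_lt_top (x := (0 : Feature d)) (r := ρ))).ne
            · refine (ae_restrict_iff' hSm).2 (haeS.mono fun u hu huS => ?_)
              have h3 := hu (by simpa using huS.2)
              have h4 : ‖u‖ ≤ 1 := (by simpa using huS.1 : ‖u‖ ≤ ρ).trans (min_le_right _ _)
              have h5 : L * ‖u‖ ^ β ≤ L := by
                have := Real.rpow_le_one (norm_nonneg u) h4 hβ.le
                nlinarith
              have h6 := abs_le.1 (hhold u)
              have h7 : |polyVal v u| ≤ 1 + L := by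
                rw [abs_le]
                constructor <;> linarith
              simp only
              rw [← sq_abs (polyVal v u)]
              exact pow_le_pow_left₀ (abs_nonneg _) h7 2
        _ = (1 + L) ^ 2 * volume.real S := by simp [mul_comm]
        _ ≤ _ := by gcongr
    intro s
    have h3 : v s ^ 2 ≤ (1 + L) ^ 2 * V / κ := by
      rw [le_div_iff₀ hκ, mul_comm]
      refine le_trans ?_ (h1.trans h2)
      gcongr
      exact Finset.single_le_sum (f := fun s => v s ^ 2) (fun _ _ => sq_nonneg _)
        (Finset.mem_univ s)
    nlinarith [sq_nonneg (|v s| - 1), sq_abs (v s), abs_nonneg (v s)]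
  have hle1 : |η y - η x| ≤ 1 := by
    rw [abs_le]
    constructor <;> linarith [hηx.1, hηx.2, hηy.1, hηy.2]
  refine le_min hle1 ?_
  have hpow : 0 ≤ L * ‖y - x‖ ^ β := by positivity
  have hnn := norm_nonneg (y - x)
  by_cases hyx : ‖y - x‖ ≤ 1
  · have h1 := abs_polyVal_sub_zero_le hvB hyx
    have h2 := hhold (y - x)
    rw [add_sub_cancel] at h2
    rw [hzero]
    calc |η y - polyVal v 0| = |(η y - polyVal v (y - x)) + (polyVal v (y - x) - polyVal v 0)| := by
          ring_nf
      _ ≤ _ := abs_add_le _ _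
      _ ≤ L * ‖y - x‖ ^ β + N * B * ‖y - x‖ := add_le_add h2 h1
      _ ≤ _ := by linarith
  · have : 0 ≤ N * B * ‖y - x‖ := by positivity
    linarith

end Modulus

/-! ### Population moments under the strong density assumption -/

section Population

variable {d : ℕ}

theorem integral_fst_eq {Q : Measure (Feature d)} {μ : Feature d → ℝ} (hμ : Measurable μ)
    (hμ0 : ∀ y, 0 ≤ μ y) (hQ : Q = volume.withDensity fun y => ENNReal.ofReal (μ y))
    (F : Feature d → ℝ) : ∫ y, F y ∂Q = ∫ y, μ y * F y := by
  rw [hQ, integral_withDensity_eq_integral_toReal_smul hμ.ennreal_ofReal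
    (Filter.Eventually.of_forall fun y => ENNReal.ofReal_lt_top)]
  simp [ENNReal.toReal_ofReal, hμ0]

theorem integrable_fst_iff {Q : Measure (Feature d)} {μ : Feature d → ℝ} (hμ : Measurable μ)
    (hμ0 : ∀ y, 0 ≤ μ y) (hQ : Q = volume.withDensity fun y => ENNReal.ofReal (μ y))
    (F : Feature d → ℝ) : Integrable F Q ↔ Integrable fun y => μ y * F y := by
  rw [hQ, integrable_withDensity_iff_integrable_smul' hμ.ennreal_ofReal
    (Filter.Eventually.of_forall fun y => ENNReal.ofReal_lt_top)]
  simp [ENNReal.toReal_ofReal, hμ0]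

theorem integral_comp_scaled (G : Feature d → ℝ) (x : Feature d) {h : ℝ} (hh : 0 < h) :
    ∫ y, G (h⁻¹ • (y - x)) = h ^ d * ∫ u, G u := by
  rw [integral_sub_right_eq_self (fun y => G (h⁻¹ • y)) x,
    Measure.integral_comp_inv_smul_of_nonneg volume G hh.le]
  simp

theorem integrable_comp_scaled {G : Feature d → ℝ} (hG : Integrable G) (x : Feature d) {h : ℝ}
    (hh : 0 < h) : Integrable fun y => G (h⁻¹ • (y - x)) :=
  (hG.comp_smul (inv_ne_zero hh.ne')).comp_sub_right x

/-- After substituting $y=x+hu$, only the part with $\|u\|\le c$ and $x+hu\in A$ is kept, where the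
kernel is at least `c` and the density at least `m`. -/
theorem le_integral_sq_polyVal {l : ℕ} {K : Feature d → ℝ} (hK : Measurable K)
    (hK0 : ∀ u, 0 ≤ K u) {Q : Measure (Feature d)} [IsFiniteMeasure Q] {μ : Feature d → ℝ}
    (hμ : Measurable μ) (hμ0 : ∀ y, 0 ≤ μ y)
    (hQ : Q = volume.withDensity fun y => ENNReal.ofReal (μ y)) {A : Set (Feature d)}
    (hAm : MeasurableSet A) {m : ℝ} (hm : 0 < m) (hμA : ∀ y ∈ A, m ≤ μ y) {c : ℝ}
    (hKc : ∀ u, ‖u‖ ≤ c → c ≤ K u) {M : ℝ}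
    (hM : ∀ (s t : MultiIndex d l) u, |mono s u * mono t u * K u| ≤ M) {h : ℝ} (hh : 0 < h)
    (x : Feature d) (v : MultiIndex d l → ℝ) :
    h ^ d * (c * m * ∫ u in {u : Feature d | u ∈ Metric.closedBall 0 c ∧ x + h • u ∈ A},
      polyVal v u ^ 2) ≤ ∫ y, polyVal v (h⁻¹ • (y - x)) ^ 2 * K (h⁻¹ • (y - x)) ∂Q := by
  set S : Set (Feature d) := {u | u ∈ Metric.closedBall 0 c ∧ x + h • u ∈ A} with hS
  have hSm : MeasurableSet S := Metric.isClosed_closedBall.measurableSet.inter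
    ((by fun_prop : Measurable fun u : Feature d => x + h • u) hAm)
  have hU : Measurable fun y : Feature d => h⁻¹ • (y - x) := by fun_prop
  have hFi : Integrable (fun y => polyVal v (h⁻¹ • (y - x)) ^ 2 * K (h⁻¹ • (y - x))) Q := by
    refine Integrable.of_bound (C := ∑ s, ∑ t, |v s * v t| * M)
      (((((continuous_polyVal v).pow 2).measurable.mul hK).comp hU).aestronglyMeasurable)
      (Filter.Eventually.of_forall fun y => ?_)
    rw [sq_polyVal, Real.norm_eq_abs, Finset.sum_mul]
    refine (Finset.abs_sum_le_sum_abs _ _).trans (Finset.sum_le_sum fun s _ => ?_)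
    rw [Finset.sum_mul]
    refine (Finset.abs_sum_le_sum_abs _ _).trans (Finset.sum_le_sum fun t _ => ?_)
    rw [mul_assoc, abs_mul]
    exact mul_le_mul_of_nonneg_left (hM s t _) (abs_nonneg _)
  have hGi : Integrable (S.indicator fun u => polyVal v u ^ 2) := by
    rw [integrable_indicator_iff hSm]
    exact (((continuous_polyVal v).pow 2).continuousOn.integrableOn_compact
      (isCompact_closedBall (0 : Feature d) c)).mono_set fun u hu => hu.1
  rw [integral_fst_eq hμ hμ0 hQ, ← integral_indicator hSm, mul_left_comm,
    ← integral_comp_scaled _ x hh, ← integral_const_mul]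
  refine integral_mono ((integrable_comp_scaled hGi x hh).const_mul _)
    ((integrable_fst_iff hμ hμ0 hQ _).1 hFi) fun y => ?_
  by_cases hy : h⁻¹ • (y - x) ∈ S
  · have h1 : y ∈ A := by
      have := hy.2
      rwa [smul_inv_smul₀ hh.ne', add_sub_cancel] at this
    have h2 : c ≤ K (h⁻¹ • (y - x)) := hKc _ (by simpa using hy.1)
    simp only [Set.indicator_of_mem hy]
    have h3 := mul_le_mul h2 (hμA y h1) hm.le (hK0 _)
    calc c * m * polyVal v (h⁻¹ • (y - x)) ^ 2
        ≤ K (h⁻¹ • (y - x)) * μ y * polyVal v (h⁻¹ • (y - x)) ^ 2 :=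
          mul_le_mul_of_nonneg_right h3 (sq_nonneg _)
      _ = _ := by ring
  · simp only [Set.indicator_of_notMem hy, mul_zero]
    exact mul_nonneg (hμ0 y) (mul_nonneg (sq_nonneg _) (hK0 _))

theorem integral_modulus_le {K : Feature d → ℝ} (hK0 : ∀ u, 0 ≤ K u) (hKi : Integrable K)
    {Q : Measure (Feature d)} {μ : Feature d → ℝ} (hμ : Measurable μ)
    (hμ0 : ∀ y, 0 ≤ μ y) (hQ : Q = volume.withDensity fun y => ENNReal.ofReal (μ y)) {m : ℝ}
    (hμm : ∀ y, μ y ≤ m) {ω : ℝ → ℝ} (hω : Measurable ω) (hω0 : ∀ r, 0 ≤ r → 0 ≤ ω r)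
    (hω1 : ∀ r, 0 ≤ r → ω r ≤ 1) {h : ℝ} (hh : 0 < h) (x : Feature d) :
    Integrable (fun y => ω ‖y - x‖ * K (h⁻¹ • (y - x))) Q ∧
    ∫ y, ω ‖y - x‖ * K (h⁻¹ • (y - x)) ∂Q ≤ h ^ d * (m * ∫ u, ω (h * ‖u‖) * K u) := by
  set G : Feature d → ℝ := fun u => ω (h * ‖u‖) * K u with hG
  have hGi : Integrable G :=
    hKi.bdd_mul (c := 1) (hω.comp (by fun_prop)).aestronglyMeasurable
      (Filter.Eventually.of_forall fun u => by
        rw [Real.norm_eq_abs, abs_of_nonneg (hω0 _ (by positivity))]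
        exact hω1 _ (by positivity))
  have hGy : ∀ y, ω ‖y - x‖ * K (h⁻¹ • (y - x)) = G (h⁻¹ • (y - x)) := fun y => by
    simp only [hG]
    rw [norm_smul, norm_inv, Real.norm_eq_abs, abs_of_pos hh, mul_inv_cancel_left₀ hh.ne']
  have hG0 : ∀ u, 0 ≤ G u := fun u => mul_nonneg (hω0 _ (by positivity)) (hK0 u)
  simp only [hGy]
  have hi := integrable_comp_scaled hGi x hh
  have hμi : Integrable fun y => μ y * G (h⁻¹ • (y - x)) :=
    hi.bdd_mul (c := m) hμ.aestronglyMeasurable (Filter.Eventually.of_forall fun y => by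
      rw [Real.norm_eq_abs, abs_of_nonneg (hμ0 y)]
      exact hμm y)
  refine ⟨(integrable_fst_iff hμ hμ0 hQ _).2 hμi, ?_⟩
  rw [integral_fst_eq hμ hμ0 hQ, mul_left_comm, ← integral_comp_scaled G x hh,
    ← integral_const_mul]
  exact integral_mono hμi (hi.const_mul m) fun y => mul_le_mul_of_nonneg_right (hμm y) (hG0 _)

theorem tendsto_integral_modulus {K : Feature d → ℝ} (hKi : Integrable K) (hK0 : ∀ u, 0 ≤ K u)
    {ω : ℝ → ℝ} (hω : Continuous ω) (hω00 : ω 0 = 0) (hω0 : ∀ r, 0 ≤ r → 0 ≤ ω r)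
    (hω1 : ∀ r, 0 ≤ r → ω r ≤ 1) :
    Filter.Tendsto (fun h : ℝ => ∫ u, ω (h * ‖u‖) * K u) (nhdsWithin 0 (Set.Ioi 0)) (nhds 0) := by
  have h0 : ∫ u : Feature d, ω (0 * ‖u‖) * K u = 0 := by simp [hω00]
  suffices H : Filter.Tendsto (fun h : ℝ => ∫ u, ω (h * ‖u‖) * K u) (nhdsWithin 0 (Set.Ioi 0))
      (nhds (∫ u : Feature d, ω (0 * ‖u‖) * K u)) by rwa [h0] at H
  refine tendsto_integral_filter_of_dominated_convergence K ?_ ?_ hKi ?_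
  · exact Filter.Eventually.of_forall fun h =>
      (hω.comp (by fun_prop)).aestronglyMeasurable.mul hKi.aestronglyMeasurable
  · filter_upwards [self_mem_nhdsWithin] with h hh
    refine Filter.Eventually.of_forall fun u => ?_
    have hr : 0 ≤ h * ‖u‖ := mul_nonneg (le_of_lt hh) (norm_nonneg u)
    rw [norm_mul, Real.norm_eq_abs, Real.norm_eq_abs, abs_of_nonneg (hω0 _ hr),
      abs_of_nonneg (hK0 u)]
    exact mul_le_of_le_one_left (hK0 u) (hω1 _ hr)
  · refine Filter.Eventually.of_forall fun u => ?_
    have : Continuous fun h : ℝ => ω (h * ‖u‖) * K u := by fun_prop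
    exact (this.tendsto 0).mono_left nhdsWithin_le_nhds

end Population

/-! ### The exponential bound -/

section Main

variable {d : ℕ} {β : ℝ} {K : Feature d → ℝ}

theorem lfloor_le (hβ : 0 < β) : (lfloor β : ℝ) ≤ β := by
  have h1 : 1 ≤ ⌈β⌉₊ := Nat.one_le_ceil_iff.2 hβ
  have h2 := Nat.ceil_lt_add_one hβ.le
  rw [lfloor, Nat.cast_sub h1]
  push_cast
  linarith

/-- A product of two monomials has degree at most $2\lfloor\beta\rfloor\le2\beta$, so it is
controlled by the weight $1+\|u\|^{2\beta}$. -/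
theorem IsAdmissibleKernel.exists_moment_bound (hβ : 0 < β) (hK : IsAdmissibleKernel β K) :
    ∃ M : ℝ, 0 < M ∧ ∀ (s t : MultiIndex d (lfloor β)) u, |mono s u * mono t u * K u| ≤ M := by
  obtain ⟨M, hM⟩ := hK.bounded
  refine ⟨max M 1, lt_max_of_lt_right one_pos, fun s t u => le_max_of_le_left ?_⟩
  refine le_trans ?_ (hM (Set.mem_range_self u))
  rw [abs_mul, abs_of_nonneg (hK.nonneg u), abs_mul]
  refine mul_le_mul_of_nonneg_right ?_ (hK.nonneg u)
  set k := ∑ j, (s.1 j : ℕ) + ∑ j, (t.1 j : ℕ) with hk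
  have hkβ : (k : ℝ) ≤ 2 * β := by
    have h1 : k ≤ 2 * lfloor β := by
      have := s.2
      have := t.2
      lia
    have h2 : (k : ℝ) ≤ 2 * (lfloor β : ℝ) := by exact_mod_cast h1
    linarith [lfloor_le hβ]
  have hpow : 0 ≤ ‖u‖ ^ (2 * β) := by positivity
  calc |mono s u| * |mono t u| ≤ ‖u‖ ^ k := by
        rw [hk, pow_add]
        exact mul_le_mul (abs_mono_le s u) (abs_mono_le t u) (abs_nonneg _) (by positivity)
    _ ≤ 1 + ‖u‖ ^ (2 * β) := by
        by_cases hu : ‖u‖ ≤ 1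
        · linarith [pow_le_one₀ (n := k) (norm_nonneg u) hu]
        · have h1 : ‖u‖ ^ k ≤ ‖u‖ ^ (2 * β) := by
            rw [← Real.rpow_natCast]
            exact Real.rpow_le_rpow_of_exponent_le (not_le.1 hu).le hkβ
          linarith

/-- The modulus of continuity `r ↦ min 1 (C r + L r ^ β)`. -/
def modulus (β C L r : ℝ) : ℝ := min 1 (C * r + L * r ^ β)

theorem continuous_modulus (hβ : 0 < β) (C L : ℝ) : Continuous (modulus β C L) := by
  have : Continuous fun r : ℝ => r ^ β := Real.continuous_rpow_const hβ.le
  unfold modulus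
  fun_prop

theorem exists_bandwidth (hK : IsAdmissibleKernel β K) (hβ : 0 < β) {C L m δ r : ℝ}
    (hC : 0 < C) (hL : 0 < L) (hδ : 0 < δ) (hr : 0 < r) :
    ∃ h : ℝ, 0 < h ∧ h ≤ r ∧ m * ∫ u, modulus β C L (h * ‖u‖) * K u ≤ δ := by
  have hω0 : ∀ r, 0 ≤ r → 0 ≤ modulus β C L r := fun r hr => le_min zero_le_one (by positivity)
  have h1 := (tendsto_integral_modulus hK.integral_eq_one.1 hK.nonneg
    (continuous_modulus hβ C L) (by simp [modulus, Real.zero_rpow hβ.ne']) hω0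
    (fun r _ => min_le_left _ _)).const_mul m
  rw [mul_zero] at h1
  have h2 : ∀ᶠ h : ℝ in nhdsWithin 0 (Set.Ioi 0), h ≤ r :=
    nhdsWithin_le_nhds (Iic_mem_nhds hr)
  obtain ⟨h, ⟨hle, hhr⟩, hh⟩ :=
    ((h1.eventually (ge_mem_nhds hδ)).and h2 |>.and self_mem_nhdsWithin).exists
  exact ⟨h, hh, hhr, hle⟩

/-- Since $\mu\ge\mu_{\min}>0$ on $A$, what holds $P_X$-almost surely holds Lebesgue-almost
everywhere on $A$. This is the form in which `exists_modulus` needs $0\le\eta\le1$. -/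
theorem InClass.ae_mem_and_ae_mem_Icc {L c₀ r₀ μmin μmax t₀ : ℝ} (hμmin : 0 < μmin)
    {A : Set (Feature d)}
    {μ : Feature d → ℝ} {P : Measure (Obs d)} {η : Feature d → ℝ} {C : Set (Feature d)}
    (hP : InClass β L c₀ r₀ μmin μmax t₀ C P η) (hμm : Measurable μ)
    (hμA : ∀ x ∈ A, μmin ≤ μ x ∧ μ x ≤ μmax) (hμ0 : ∀ x, x ∉ A → μ x = 0)
    (hQ : P.fst = volume.withDensity fun x => ENNReal.ofReal (μ x)) :
    (∀ᵐ z ∂P, z.1 ∈ A) ∧ ∀ᵐ y, y ∈ A → 0 ≤ η y ∧ η y ≤ 1 := by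
  have hprob := hP.isProb
  constructor
  · refine ae_of_ae_map measurable_fst.aemeasurable (p := fun x => x ∈ A) ?_
    change ∀ᵐ x ∂P.fst, x ∈ A
    rw [hQ, ae_withDensity_iff hμm.ennreal_ofReal]
    refine Filter.Eventually.of_forall fun x hx => ?_
    by_contra hxA
    simp [hμ0 x hxA] at hx
  · have h1 : ∀ᵐ x ∂P.fst, 0 ≤ η x ∧ η x ≤ 1 := by
      have hm : MeasurableSet {x | 0 ≤ η x ∧ η x ≤ 1} :=
        (measurableSet_le measurable_const hP.regression.1).inter
          (measurableSet_le hP.regression.1 measurable_const)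
      exact (ae_map_iff measurable_fst.aemeasurable hm).2 hP.regression.ae_mem_Icc
    rw [hQ, ae_withDensity_iff hμm.ennreal_ofReal] at h1
    filter_upwards [h1] with y hy hyA
    refine hy ?_
    have := (hμA y hyA).1
    simpa using hμmin.trans_le this

/-- At almost every point where the regression function differs from `1/2`, the classifier agrees
with the Bayes rule up to an exponentially small probability. -/
theorem exists_pointwise_bound {L c₀ r₀ μmin μmax t₀ : ℝ} (hβ : 0 < β) (hL : 0 < L)
    (hc₀ : 0 < c₀) (hr₀ : 0 < r₀) (hμmin : 0 < μmin) (hμ : μmin < μmax) (ht₀ : 0 < t₀)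
    (hK : IsAdmissibleKernel β K) :
    ∃ (h B γ : ℝ) (n₀ : ℕ), 0 < h ∧ 0 ≤ B ∧ 0 < γ ∧ ∀ n : ℕ, 0 < n → n₀ ≤ n →
      ∀ (C : Set (Feature d)) (P : Measure (Obs d)) (η : Feature d → ℝ),
        InClass β L c₀ r₀ μmin μmax t₀ C P η → ∀ᵐ z ∂P, η z.1 ≠ 1 / 2 →
          (Measure.pi fun _ : Fin n => P).real
            {D | plugInClassifier β K h D z.1 ≠ plugInRule η z.1} ≤ B * Real.exp (-γ * n) := by
  obtain ⟨M, hM0, hM⟩ := hK.exists_moment_bound hβ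
  obtain ⟨c, hc, hKc⟩ := hK.lower
  obtain ⟨κ, hκ, Hκ⟩ := exists_sq_sum_le_setIntegral d (lfloor β) hc hc₀
  obtain ⟨Cω, hCω, Hω⟩ := exists_modulus d hβ hL hc₀ hr₀
  -- Half of the population lower bound, without its factor $h^d$; the other half is reserved for
  -- the sampling error. It has to be fixed before `h`, whose choice depends on it.
  set a₀ := c * μmin * κ / 2 with ha₀def
  have ha₀ : 0 < a₀ := by positivity
  obtain ⟨h, hh, hhr, hhω⟩ := exists_bandwidth (m := μmax) (δ := a₀ * t₀ ^ 2 / 32) hK hβ hCω hL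
    (by positivity) (div_pos hr₀ hc)
  set a := a₀ * h ^ d with hadef
  have ha : 0 < a := by positivity
  set N : ℝ := (Fintype.card (MultiIndex d (lfloor β)) : ℝ) with hN
  have hN0 : 0 ≤ N := Nat.cast_nonneg _
  -- The three terms serve the design matrix, the noise and the bias moment. Bias and its
  -- fluctuation each receive `a * t₀ ^ 2 / 32`, half of the allowance in `16 * (b + ε) ≤ a * t₀ ^
  -- 2`.
  set ε := min (a / (1 + N)) (min (a * t₀ / (8 * (1 + N))) (a * t₀ ^ 2 / 32)) with hεdef
  have hε : 0 < ε := lt_min (by positivity) (lt_min (by positivity) (by positivity))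
  have hε1 : ε * (1 + N) ≤ a := (le_div_iff₀ (by positivity)).1 (min_le_left _ _)
  have hε2 : ε * (8 * (1 + N)) ≤ a * t₀ :=
    (le_div_iff₀ (by positivity)).1 ((min_le_right _ _).trans (min_le_left _ _))
  have hε3 : ε ≤ a * t₀ ^ 2 / 32 := (min_le_right _ _).trans (min_le_right _ _)
  -- The threshold on `n` ensures `1 / a₀ < log n`, so that the eigenvalue bound `a / h ^ d = a₀`
  -- passes the test.
  refine ⟨h, 2 * Fintype.card ((MultiIndex d (lfloor β) × MultiIndex d (lfloor β)) ⊕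
    (MultiIndex d (lfloor β) ⊕ Unit)), ε ^ 2 / (2 * M ^ 2), ⌈Real.exp (1 / a₀)⌉₊ + 1, hh,
    by positivity, by positivity, ?_⟩
  intro n hn hn₀ C P η hP
  have hprob := hP.isProb
  obtain ⟨A, μ, hAc, -, hAreg, hμm, hμA, hμ0, hQ⟩ := hP.density
  have hAm := hAc.measurableSet
  have hμnn : ∀ y, 0 ≤ μ y := fun y => by
    by_cases hy : y ∈ A
    · exact hμmin.le.trans (hμA y hy).1
    · exact (hμ0 y hy).ge
  have hμle : ∀ y, μ y ≤ μmax := fun y => by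
    by_cases hy : y ∈ A
    · exact (hμA y hy).2
    · rw [hμ0 y hy]
      exact (hμmin.trans hμ).le
  obtain ⟨haeA, haeη⟩ := hP.ae_mem_and_ae_mem_Icc hμmin hμm hμA hμ0 hQ
  have hmargin : ∀ᵐ z ∂P, ¬(0 < |η z.1 - 1 / 2| ∧ |η z.1 - 1 / 2| ≤ t₀) := by
    refine ae_of_ae_map measurable_fst.aemeasurable
      (p := fun x => ¬(0 < |η x - 1 / 2| ∧ |η x - 1 / 2| ≤ t₀)) ?_
    rw [ae_iff]
    simp only [not_not]
    exact hP.margin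
  filter_upwards [haeA, hmargin, hP.regression.ae_mem_Icc] with z hzA hzm hzη hne
  obtain ⟨x, y⟩ := z
  simp only at hzA hzm hzη hne ⊢
  have hηt : t₀ < |η x - 1 / 2| := by
    by_contra hcon
    exact hzm ⟨abs_pos.2 (sub_ne_zero.2 hne), not_lt.1 hcon⟩
  have hU : Measurable fun y : Feature d => h⁻¹ • (y - x) := by fun_prop
  have hint : ∀ F : Feature d → ℝ, Measurable F → ∫ z, F z.1 ∂P = ∫ y, F y ∂P.fst :=
    fun F hF => (integral_map measurable_fst.aemeasurable hF.aestronglyMeasurable).symm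
  refine measureReal_plugInClassifier_ne_le (a := a) (b := a * t₀ ^ 2 / 32) (t := t₀) (ε := ε)
    hP.regression hn hh hK.measurable hK.nonneg hM0 hM hzη ha ht₀ hε ?_ ?_ ?_ ?_ ?_ hηt ?_
  · intro v
    rw [hint (fun y => polyVal v (h⁻¹ • (y - x)) ^ 2 * K (h⁻¹ • (y - x)))
      ((((continuous_polyVal v).measurable.comp hU).pow_const 2).mul (hK.measurable.comp hU))]
    refine le_trans ?_ (le_integral_sq_polyVal hK.measurable hK.nonneg hμm hμnn hQ hAm hμmin
      (fun y hy => (hμA y hy).1) hKc hM hh x v)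
    have h1 := Hκ v {u : Feature d | u ∈ Metric.closedBall 0 c ∧ x + h • u ∈ A}
      (Metric.isClosed_closedBall.measurableSet.inter
        ((by fun_prop : Measurable fun u : Feature d => x + h • u) hAm)) (fun u hu => hu.1)
      (hAreg.le_volume hzA hh hc ((le_div_iff₀ hc).1 hhr))
    calc 2 * a * ∑ s, v s ^ 2 = h ^ d * (c * μmin * (κ * ∑ s, v s ^ 2)) := by
          rw [hadef, ha₀def]
          ring
      _ ≤ _ := by gcongr
  · have hω := integral_modulus_le (ω := modulus β Cω L) hK.nonneg hK.integral_eq_one.1 hμm hμnn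
      hQ hμle (continuous_modulus hβ Cω L).measurable
      (fun r hr => le_min zero_le_one (by positivity)) (fun r _ => min_le_left _ _) hh x
    have hωP : Integrable (fun z : Obs d => modulus β Cω L ‖z.1 - x‖ * K (h⁻¹ • (z.1 - x))) P :=
      hω.1.comp_measurable measurable_fst
    calc ∫ z, (η z.1 - η x) ^ 2 * K (h⁻¹ • (z.1 - x)) ∂P
        ≤ ∫ z, modulus β Cω L ‖z.1 - x‖ * K (h⁻¹ • (z.1 - x)) ∂P := by
          refine integral_mono_of_nonneg (Filter.Eventually.of_forall fun z =>
            mul_nonneg (sq_nonneg _) (hK.nonneg _)) hωP ?_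
          filter_upwards [hP.regression.ae_mem_Icc] with z hz
          refine mul_le_mul_of_nonneg_right ?_ (hK.nonneg _)
          have h1 := Hω η A hP.holder hAm hAreg haeη x hzA hzη z.1 hz
          have h2 := h1.trans (min_le_left _ _)
          rw [← sq_abs]
          refine le_trans ?_ h1
          nlinarith [abs_nonneg (η z.1 - η x)]
      _ = ∫ y, modulus β Cω L ‖y - x‖ * K (h⁻¹ • (y - x)) ∂P.fst :=
          hint (fun y => modulus β Cω L ‖y - x‖ * K (h⁻¹ • (y - x)))
            (((continuous_modulus hβ Cω L).measurable.comp (by fun_prop)).mul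
              (hK.measurable.comp hU))
      _ ≤ h ^ d * (a₀ * t₀ ^ 2 / 32) := hω.2.trans (by gcongr)
      _ = a * t₀ ^ 2 / 32 := by
          rw [hadef]
          ring
  · linarith
  · linarith
  · linarith
  · rw [hadef, mul_div_assoc, div_self (by positivity), mul_one]
    have hexp : Real.exp (1 / a₀) < n := by
      have h1 := Nat.le_ceil (Real.exp (1 / a₀))
      have h2 : ((⌈Real.exp (1 / a₀)⌉₊ + 1 : ℕ) : ℝ) ≤ n := by exact_mod_cast hn₀
      push_cast at h2
      linarith
    have hlog := (Real.lt_log_iff_exp_lt (by exact_mod_cast hn)).2 hexp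
    rw [div_lt_iff₀ ha₀] at hlog
    linarith

end Main

end PlugIn

end

theorem mainTheorem9 (d : ℕ) (hd : 1 ≤ d) (β L c₀ r₀ μmin μmax t₀ : ℝ)
    (hβ : 0 < β) (hL : 0 < L) (hc₀ : 0 < c₀) (hr₀ : 0 < r₀)
    (hμmin : 0 < μmin) (hμ : μmin < μmax) (ht₀ : 0 < t₀)
    (K : PlugIn.Feature d → ℝ) (hK : PlugIn.IsAdmissibleKernel β K) :
    ∃ h C₄ C₅ : ℝ, 0 < h ∧ 0 < C₄ ∧ 0 < C₅ ∧
      ∀ n : ℕ, 1 ≤ n →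
        Measurable (fun p : (Fin n → PlugIn.Obs d) × PlugIn.Feature d =>
          PlugIn.plugInClassifier β K h p.1 p.2) ∧
        ∀ C : Set (PlugIn.Feature d), IsCompact C →
          ∀ (P : MeasureTheory.Measure (PlugIn.Obs d)) (η : PlugIn.Feature d → ℝ),
            PlugIn.InClass β L c₀ r₀ μmin μmax t₀ C P η →
              PlugIn.excessRisk P η
                  (fun D : Fin n → PlugIn.Obs d => PlugIn.plugInClassifier β K h D)
                ≤ C₄ * Real.exp (-C₅ * n) := by
  obtain ⟨h, B, γ, n₀, hh, hB, hγ, H⟩ :=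
    PlugIn.exists_pointwise_bound hβ hL hc₀ hr₀ hμmin hμ ht₀ hK
  -- For `n < n₀` the trivial bound `1` on the probability is at most `exp (γ * n₀) * exp (-γ * n)`.
  refine ⟨h, B + Real.exp (γ * n₀), γ, hh, by positivity, hγ, fun n hn => ?_⟩
  have hmeas := PlugIn.measurable_plugInClassifier (n := n) (β := β) hK.measurable hn hh
  refine ⟨hmeas, fun C _ P η hP => ?_⟩
  have hprob := hP.isProb
  refine PlugIn.excessRisk_le hP.regression hmeas ?_ (by positivity)
  by_cases hn₀ : n₀ ≤ n
  · filter_upwards [H n hn hn₀ C P η hP] with z hz hne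
    refine (hz hne).trans ?_
    gcongr
    exact le_add_of_nonneg_right (Real.exp_pos _).le
  · refine Filter.Eventually.of_forall fun z _ => measureReal_le_one.trans ?_
    have h1 : (n : ℝ) ≤ n₀ := by exact_mod_cast (not_le.1 hn₀).le
    have h2 : 1 ≤ Real.exp (γ * n₀) * Real.exp (-γ * n) := by
      rw [← Real.exp_add]
      refine Real.one_le_exp ?_
      nlinarith
    have h3 : 0 ≤ B * Real.exp (-γ * n) := by positivity
    linarith
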